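/- Let $d\in\mathbb N$, $0<s<1$, and let $\Omega\subset\mathbb R^d$ be a bounded open set. Let $0<g_*\le g^*$ and $0<k_*\le k^*$ be constants and let $g:\mathbb R^d\times\mathbb R^d\times(0,\infty)\to(0,\infty)$ be measurable and such that, for a.e. $(x,y)\in\mathbb R^d\times\mathbb R^d$, and also at the pair $(x,x)$ for a.e. $x\in\mathbb R^d$: the function $r\mapsto g(x,y,r)$ is locally Lipschitz on $(0,\infty)$, $\lim_{r\to0^+}r\,g(x,y,r)=0$, $\lim_{r\to+\infty}r\,g(x,y,r)=+\infty$, $$g_*\le \frac{r\,g'(x,y,r)}{g(x,y,r)}+1\le g^*\quad\text{at every } r>0 \text{ where the derivative } g'=\partial_r g \text{ exists},\qquad k_*\le g(x,y,1)\le k^* .$$ Assume $s(g_*+1)<d$. Put $G(x,y,r)=\int_0^r g(x,y,\rho)\rho\,d\rho$ and $\delta^su(x,y)=\frac{u(x)-u(y)}{|x-y|^s}$. Let $W^{s,G}(\mathbb R^d)$ be the space of measurable $u:\mathbb R^d\to\mathbb R$ for which $\int_{\mathbb R^d} G(x,x,|u(x)|)\,dx$ and $\iint_{\mathbb R^d\times\mathbb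 R^d} G(x,y,|\delta^su(x,y)|)\frac{dx\,dy}{|x-y|^d}$ are finite, normed by the sum of the Luxemburg (semi)norms of these two modulars. For $U\subset\mathbb R^d$ open let $W^{s,G}_0(U)$ be the closure of $C_c^\infty(U)$ in $W^{s,G}(\mathbb R^d)$, and let $$\langle\mathcal L^s_gu,v\rangle=\iint_{\mathbb R^d\times\mathbb R^d} g(x,y,|\delta^su|)\,\delta^su\,\delta^sv\,\frac{dx\,dy}{|x-y|^d}.$$ The dual of $W_0^{s,G}(\Omega)$ is ordered by $\Lambda_1\le\Lambda_2$ iff $\langle\Lambda_1,v\rangle\le\langle\Lambda_2,v\rangle$ for all $v\in W_0^{s,G}(\Omega)$ with $v\ge0$ a.e.; $\vee$ and $\wedge$ denote the least upper and the greatest lower bound in this order, a function $h$ on $\Omega$ is identified with $v\mapsto\int_\Omega hv\,dx$, and $\mathcal L_g^s\psi$ is regarded as the functional $v\mapsto\langle\mathcal L_g^s\psi,v\rangle$ on $W_0^{s,G}(\Omega)$. "$f\vee\mathcal L_g^s\psi\in L^m(\Omega)$" means that this least upper bound exists and is given by a function in $L^m(\Omega)$, and similarly for $\wedge$. Let $\frac{d}{s(g_*+1)}<m\le\infty$,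 $f\in L^m(\Omega)$, let $\psi\in W_0^{s,G}(\mathbb R^d)$ satisfy $\psi\le0$ a.e. in $\mathbb R^d\setminus\Omega$, and suppose $f\vee\mathcal L_g^s\psi\in L^m(\Omega)$. (i) If $u$ is the solution of the one-obstacle problem $$u\in\mathbb K:\quad \langle\mathcal L_g^su,v-u\rangle-\int_\Omega f\,(v-u)\,dx\ge0\quad\forall v\in\mathbb K,$$ with $\mathbb K=\{v\in W_0^{s,G}(\Omega): v\ge\psi\text{ a.e. in }\Omega\}$, then $u\in L^\infty(\Omega)$. (ii) If in addition $\varphi\in W_0^{s,G}(\mathbb R^d)$ satisfies $\varphi\ge0$ a.e. in $\mathbb R^d\setminus\Omega$ and $f\wedge\mathcal L_g^s\varphi\in L^m(\Omega)$, and $u$ is the solution of the two-obstacles problem, i.e. of the same variational inequality with $\mathbb K=\{v\in W_0^{s,G}(\Omega):\psi\le v\le\varphi\text{ a.e. in }\Omega\}$, then $u\in L^\infty(\Omega)$. -/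

import Mathlib

open MeasureTheory Set Filter Topology
open scoped ENNReal NNReal ContDiff

namespace FracObstacle

/-- The Euclidean space `ℝ^d`. -/
abbrev Eucl (d : ℕ) := EuclideanSpace ℝ (Fin d)

/-- The pointwise structural conditions on `r ↦ g(x,y,r)`, `r > 0`, for a fixed pair `(x,y)`:
positivity, (local) Lipschitz continuity, the limits of `r g(r)` at `0⁺` and `+∞`, the growth
condition `g_* ≤ r g'(r) / g(r) + 1 ≤ g^*` wherever the derivative exists (which is almost
everywhere), and the normalisation `k_* ≤ g(1) ≤ k^*`. -/
structure IsAdmissibleAt (gl gu kl ku : ℝ) (γ : ℝ → ℝ) : Prop where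
  pos : ∀ r, 0 < r → 0 < γ r
  lipschitz : LocallyLipschitzOn (Ioi 0) γ
  tendsto_zero : Tendsto (fun r => r * γ r) (𝓝[>] 0) (𝓝 0)
  tendsto_top : Tendsto (fun r => r * γ r) atTop atTop
  growth : ∀ r, 0 < r → DifferentiableAt ℝ γ r →
    gl ≤ r * deriv γ r / γ r + 1 ∧ r * deriv γ r / γ r + 1 ≤ gu
  bound_one : kl ≤ γ 1 ∧ γ 1 ≤ ku

/-- The assumptions on the nonlinearity `g(x,y,r)`. They are required for almost every `(x,y)`,
and also for almost every point `(x,x)` of the diagonal, because the space `L^Ĝ` is defined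
through the values of `G` on the diagonal. Only the values at `r > 0` matter. -/
structure IsAdmissible {d : ℕ} (gl gu kl ku : ℝ) (g : Eucl d → Eucl d → ℝ → ℝ) : Prop where
  gl_pos : 0 < gl
  gl_le_gu : gl ≤ gu
  kl_pos : 0 < kl
  kl_le_ku : kl ≤ ku
  measurable : Measurable fun z : Eucl d × Eucl d × ℝ => g z.1 z.2.1 z.2.2
  ae : ∀ᵐ z : Eucl d × Eucl d, IsAdmissibleAt gl gu kl ku (g z.1 z.2)
  ae_diag : ∀ᵐ x : Eucl d, IsAdmissibleAt gl gu kl ku (g x x)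

/-- `G(x,y,r) = ∫₀^r g(x,y,ρ) ρ dρ`. -/
noncomputable def bigG {d : ℕ} (g : Eucl d → Eucl d → ℝ → ℝ) (x y : Eucl d) (r : ℝ) : ℝ :=
  ∫ ρ in (0 : ℝ)..r, g x y ρ * ρ

/-- The two-point `s`-difference quotient `δ^s u(x,y) = (u(x) - u(y)) / |x-y|^s`. -/
noncomputable def diffQuot {d : ℕ} (s : ℝ) (u : Eucl d → ℝ) (x y : Eucl d) : ℝ :=
  (u x - u y) / ‖x - y‖ ^ s

/-- The modular `∫ G(x,x,|u(x)|) dx`. -/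
noncomputable def modularG {d : ℕ} (g : Eucl d → Eucl d → ℝ → ℝ) (u : Eucl d → ℝ) : ℝ≥0∞ :=
  ∫⁻ x, ENNReal.ofReal (bigG g x x |u x|)

/-- The modular `∬ G(x,y,|δ^s u(x,y)|) dx dy / |x-y|^d`. -/
noncomputable def modularSG {d : ℕ} (s : ℝ) (g : Eucl d → Eucl d → ℝ → ℝ)
    (u : Eucl d → ℝ) : ℝ≥0∞ :=
  ∫⁻ z : Eucl d × Eucl d,
    ENNReal.ofReal (bigG g z.1 z.2 |diffQuot s u z.1 z.2| / ‖z.1 - z.2‖ ^ d)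

/-- The Luxemburg functional `inf {l > 0 : Γ(u / l) ≤ 1}` of a modular `Γ` (`∞` if there is no
such `l`). -/
noncomputable def luxemburg {d : ℕ} (Γ : (Eucl d → ℝ) → ℝ≥0∞) (u : Eucl d → ℝ) : ℝ≥0∞ :=
  sInf {t : ℝ≥0∞ | ∃ l : ℝ, 0 < l ∧ Γ (fun x => u x / l) ≤ 1 ∧ t = ENNReal.ofReal l}

/-- The norm `‖u‖_{s,G} = ‖u‖_G + [u]_{s,G}` of `W^{s,G}(ℝ^d)`. -/
noncomputable def normW {d : ℕ} (s : ℝ) (g : Eucl d → Eucl d → ℝ → ℝ) (u : Eucl d → ℝ) : ℝ≥0∞ :=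
  luxemburg (modularG g) u + luxemburg (modularSG s g) u

/-- `u ∈ W^{s,G}(ℝ^d)`. -/
def MemW {d : ℕ} (s : ℝ) (g : Eucl d → Eucl d → ℝ → ℝ) (u : Eucl d → ℝ) : Prop :=
  AEStronglyMeasurable u volume ∧ modularG g u < ⊤ ∧ modularSG s g u < ⊤

/-- `u ∈ W^{s,G}_0(Ω)`, the closure of `C_c^∞(Ω)` in `W^{s,G}(ℝ^d)`. -/
def MemW0 {d : ℕ} (s : ℝ) (g : Eucl d → Eucl d → ℝ → ℝ) (Ω : Set (Eucl d))
    (u : Eucl d → ℝ) : Prop :=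
  MemW s g u ∧ ∀ ε : ℝ≥0∞, 0 < ε → ∃ w : Eucl d → ℝ,
    ContDiff ℝ ∞ w ∧ HasCompactSupport w ∧ tsupport w ⊆ Ω ∧ normW s g (u - w) < ε

/-- `⟨ℒ_g^s u, v⟩`. -/
noncomputable def opL {d : ℕ} (s : ℝ) (g : Eucl d → Eucl d → ℝ → ℝ) (u v : Eucl d → ℝ) : ℝ :=
  ∫ z : Eucl d × Eucl d, g z.1 z.2 |diffQuot s u z.1 z.2| * diffQuot s u z.1 z.2
    * diffQuot s v z.1 z.2 / ‖z.1 - z.2‖ ^ d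

/-- The functional `v ↦ ∫_Ω f v` attached to a function `f`. -/
noncomputable def pairing {d : ℕ} (Ω : Set (Eucl d)) (f v : Eucl d → ℝ) : ℝ :=
  ∫ x in Ω, f x * v x

/-- `Λ` belongs to the dual of `W^{s,G}_0(Ω)`: it is linear and bounded on `W^{s,G}_0(Ω)`
(its values elsewhere are irrelevant). -/
structure IsDual {d : ℕ} (s : ℝ) (g : Eucl d → Eucl d → ℝ → ℝ) (Ω : Set (Eucl d))
    (Λ : (Eucl d → ℝ) → ℝ) : Prop where
  map_add : ∀ v w, MemW0 s g Ω v → MemW0 s g Ω w → Λ (v + w) = Λ v + Λ w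
  map_smul : ∀ (c : ℝ) (v), MemW0 s g Ω v → Λ (c • v) = c * Λ v
  bounded : ∃ C : ℝ≥0, ∀ v, MemW0 s g Ω v → ‖Λ v‖ₑ ≤ C * normW s g v

/-- The order of the dual of `W^{s,G}_0(Ω)`: `Λ₁ ≤ Λ₂` iff `⟨Λ₁, v⟩ ≤ ⟨Λ₂, v⟩` for all
`0 ≤ v ∈ W^{s,G}_0(Ω)`. -/
def DualLE {d : ℕ} (s : ℝ) (g : Eucl d → Eucl d → ℝ → ℝ) (Ω : Set (Eucl d))
    (Λ₁ Λ₂ : (Eucl d → ℝ) → ℝ) : Prop :=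
  ∀ v, MemW0 s g Ω v → (∀ᵐ x, 0 ≤ v x) → Λ₁ v ≤ Λ₂ v

/-- `Λ = Λ₁ ∨ Λ₂`: least upper bound in the ordered dual of `W^{s,G}_0(Ω)`. -/
structure IsDualSup {d : ℕ} (s : ℝ) (g : Eucl d → Eucl d → ℝ → ℝ) (Ω : Set (Eucl d))
    (Λ₁ Λ₂ Λ : (Eucl d → ℝ) → ℝ) : Prop where
  isDual : IsDual s g Ω Λ
  left_le : DualLE s g Ω Λ₁ Λ
  right_le : DualLE s g Ω Λ₂ Λ
  least : ∀ Λ', IsDual s g Ω Λ' → DualLE s g Ω Λ₁ Λ' → DualLE s g Ω Λ₂ Λ' → DualLE s g Ω Λ Λ'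

/-- `Λ = Λ₁ ∧ Λ₂`: greatest lower bound in the ordered dual of `W^{s,G}_0(Ω)`. -/
structure IsDualInf {d : ℕ} (s : ℝ) (g : Eucl d → Eucl d → ℝ → ℝ) (Ω : Set (Eucl d))
    (Λ₁ Λ₂ Λ : (Eucl d → ℝ) → ℝ) : Prop where
  isDual : IsDual s g Ω Λ
  le_left : DualLE s g Ω Λ Λ₁
  le_right : DualLE s g Ω Λ Λ₂
  greatest : ∀ Λ', IsDual s g Ω Λ' → DualLE s g Ω Λ' Λ₁ → DualLE s g Ω Λ' Λ₂ → DualLE s g Ω Λ' Λ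

/-- `f ∨ ℒ_g^s ψ ∈ L^m(Ω)`. -/
def SupMemLp {d : ℕ} (s : ℝ) (g : Eucl d → Eucl d → ℝ → ℝ) (Ω : Set (Eucl d)) (m : ℝ≥0∞)
    (f ψ : Eucl d → ℝ) : Prop :=
  ∃ h : Eucl d → ℝ, MemLp h m (volume.restrict Ω) ∧
    IsDualSup s g Ω (pairing Ω f) (opL s g ψ) (pairing Ω h)

/-- `f ∧ ℒ_g^s φ ∈ L^m(Ω)`. -/
def InfMemLp {d : ℕ} (s : ℝ) (g : Eucl d → Eucl d → ℝ → ℝ) (Ω : Set (Eucl d)) (m : ℝ≥0∞)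
    (f φ : Eucl d → ℝ) : Prop :=
  ∃ h : Eucl d → ℝ, MemLp h m (volume.restrict Ω) ∧
    IsDualInf s g Ω (pairing Ω f) (opL s g φ) (pairing Ω h)

/-- The one-obstacle set `{v ∈ W^{s,G}_0(Ω) : v ≥ ψ a.e. in Ω}`. -/
def obstacleSet₁ {d : ℕ} (s : ℝ) (g : Eucl d → Eucl d → ℝ → ℝ) (Ω : Set (Eucl d))
    (ψ : Eucl d → ℝ) : Set (Eucl d → ℝ) :=
  {v | MemW0 s g Ω v ∧ ∀ᵐ x ∂volume.restrict Ω, ψ x ≤ v x}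

/-- The two-obstacles set `{v ∈ W^{s,G}_0(Ω) : ψ ≤ v ≤ φ a.e. in Ω}`. -/
def obstacleSet₂ {d : ℕ} (s : ℝ) (g : Eucl d → Eucl d → ℝ → ℝ) (Ω : Set (Eucl d))
    (ψ φ : Eucl d → ℝ) : Set (Eucl d → ℝ) :=
  {v | MemW0 s g Ω v ∧ ∀ᵐ x ∂volume.restrict Ω, ψ x ≤ v x ∧ v x ≤ φ x}

/-- `u ∈ K` and `⟨ℒ_g^s u - F, v - u⟩ ≥ 0` for all `v ∈ K`. -/
def IsObstacleSolution {d : ℕ} (s : ℝ) (g : Eucl d → Eucl d → ℝ → ℝ)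
    (F : (Eucl d → ℝ) → ℝ) (K : Set (Eucl d → ℝ)) (u : Eucl d → ℝ) : Prop :=
  u ∈ K ∧ ∀ v ∈ K, 0 ≤ opL s g u (v - u) - F (v - u)

end FracObstacle

namespace FracObstacle

/-! ### Growth and doubling of r ↦ γ(r) r and of its primitive. -/

section Scalar

variable {gl gu kl ku : ℝ} {γ : ℝ → ℝ}

/-! The proof is a Stampacchia level-set iteration in which the Sobolev inequality is replaced by a
direct estimate of the measure of pairs of points. Let a(k) = |{w > k}|, let T vanish below k and
equal τ/C above k + τ, and suppose that ⟨ℒw, T(w)⟩ ≤ ∫ h T(w) for all k ≥ k₀ and τ > 0. Choose ρ so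
that balls of radius ρ have volume 2a(k). Around each x with w(x) > k + τ, a part of the ball of
measure at least a(k) lies in {w ≤ k}, so pairs across the truncation at distance less than ρ have
measure at least a(k+τ) a(k) (`mul_volume_le_volume_pairs`). If τ/C ≥ ρ^s, the quotients on these
pairs are at least 1, a range where g(r) r ≥ k_* r^{g_*}; this bounds the energy from below
(`mul_volume_pairs_le_opL`). Hölder's inequality bounds the right-hand side by (τ/C) ‖h‖_m
a(k)^{1-1/m} (`pairing_smoothTrunc_le`). Together, a(k+τ) τ^{g_*} ≤ K a(k)^{1+ε} with ε = s(g_*+1)/d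
- 1/m, which the condition on m makes positive, and `exists_eq_zero_of_decay` gives a(M) = 0 for
some M. This is `exists_le_of_energy_le`.

It is applied first to ψ with h = f ∨ ℒψ, because ℒψ ≤ h, and in the two-obstacles case also to -φ.
Once ψ ≤ M, the function u - T(u) still lies above ψ for k ≥ M, so it is a competitor and the
variational inequality becomes the energy inequality for u with h = f. The lower bound is the same
argument for -u.

The test functions must lie in a closure of C_c^∞(Ω). Hence the truncations are smooth, and
`MemW0.comp` shows that smooth Lipschitz maps preserve this closure, by dominated convergence for
modulars. -/

theorem absolutelyContinuous_mul_rpow (hγ : LocallyLipschitzOn (Ioi 0) γ) (c : ℝ) {a b : ℝ}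
    (ha : 0 < a) (hab : a ≤ b) :
    AbsolutelyContinuousOnInterval (fun r => γ r * r ^ c) a b := by
  have hsub : uIcc a b ⊆ Ioi 0 := by
    rw [uIcc_of_le hab]
    exact fun x hx => ha.trans_le hx.1
  obtain ⟨K, hK⟩ := (hγ.mono hsub).exists_lipschitzOnWith_of_compact isCompact_uIcc
  refine hK.absolutelyContinuousOnInterval.mul (ContDiffOn.absolutelyContinuousOnInterval ?_)
  exact contDiffOn_id.rpow_const_of_ne fun x hx => (hsub hx).ne'

theorem hasDerivAt_mul_rpow {r : ℝ} (hr : 0 < r) (hd : DifferentiableAt ℝ γ r) (c : ℝ) :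
    HasDerivAt (fun r => γ r * r ^ (1 - c)) (r ^ (-c) * (r * deriv γ r + 1 * γ r - c * γ r)) r := by
  refine (hd.hasDerivAt.mul (Real.hasDerivAt_rpow_const (Or.inl hr.ne'))).congr_deriv ?_
  have h1 : r ^ (1 - c) = r * r ^ (-c) := by
    rw [sub_eq_add_neg, Real.rpow_add hr, Real.rpow_one]
  have h2 : r ^ (1 - c - 1) = r ^ (-c) := by congr 1; ring
  rw [h1, h2]; ring

/-- The derivative r^{-g_*}(r γ' + γ - g_* γ) is nonnegative by the growth condition wherever γ is
differentiable, and local Lipschitz continuity permits integrating it. -/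
theorem IsAdmissibleAt.mul_rpow_mono (h : IsAdmissibleAt gl gu kl ku γ) {a b : ℝ} (ha : 0 < a)
    (hab : a ≤ b) : γ a * a ^ (1 - gl) ≤ γ b * b ^ (1 - gl) := by
  have hac := absolutelyContinuous_mul_rpow h.lipschitz (1 - gl) ha hab
  -- With exponent 0 the product is γ itself, so this yields differentiability of γ almost
  -- everywhere.
  have hac' := absolutelyContinuous_mul_rpow h.lipschitz 0 ha hab
  have hd := hac'.ae_differentiableAt
  rw [← sub_nonneg, ← hac.integral_deriv_eq_sub]
  refine intervalIntegral.integral_nonneg_of_ae_restrict hab ?_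
  rw [EventuallyLE, ae_restrict_iff' measurableSet_Icc]
  filter_upwards [hd] with r hr hmem
  have hr0 : 0 < r := ha.trans_le hmem.1
  have hdr : DifferentiableAt ℝ γ r := by simpa using hr (by rwa [uIcc_of_le hab])
  rw [(hasDerivAt_mul_rpow hr0 hdr gl).deriv]
  have hpos := h.pos r hr0
  have hg := (h.growth r hr0 hdr).1
  have : gl * γ r ≤ r * deriv γ r + 1 * γ r := by
    have := mul_le_mul_of_nonneg_right hg hpos.le
    rwa [add_mul, div_mul_cancel₀ _ hpos.ne'] at this
  exact mul_nonneg (Real.rpow_nonneg hr0.le _) (by simpa using this)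

theorem IsAdmissibleAt.mul_rpow_anti (h : IsAdmissibleAt gl gu kl ku γ) {a b : ℝ} (ha : 0 < a)
    (hab : a ≤ b) : γ b * b ^ (1 - gu) ≤ γ a * a ^ (1 - gu) := by
  have hac := absolutelyContinuous_mul_rpow h.lipschitz (1 - gu) ha hab
  have hac' := absolutelyContinuous_mul_rpow h.lipschitz 0 ha hab
  have hd := hac'.ae_differentiableAt
  rw [← sub_nonneg, ← neg_sub, ← hac.integral_deriv_eq_sub, ← intervalIntegral.integral_neg]
  refine intervalIntegral.integral_nonneg_of_ae_restrict hab ?_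
  rw [EventuallyLE, ae_restrict_iff' measurableSet_Icc]
  filter_upwards [hd] with r hr hmem
  have hr0 : 0 < r := ha.trans_le hmem.1
  have hdr : DifferentiableAt ℝ γ r := by simpa using hr (by rwa [uIcc_of_le hab])
  rw [(hasDerivAt_mul_rpow hr0 hdr gu).deriv]
  have hpos := h.pos r hr0
  have hg := (h.growth r hr0 hdr).2
  have : r * deriv γ r + 1 * γ r ≤ gu * γ r := by
    have := mul_le_mul_of_nonneg_right hg hpos.le
    rwa [add_mul, div_mul_cancel₀ _ hpos.ne'] at this
  have h3 : 0 ≤ r ^ (-gu) := Real.rpow_nonneg hr0.le _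
  simp only [Pi.zero_apply]
  nlinarith

/-- `γ(l r) l r ≤ l^{g^*} γ(r) r` for `l ≥ 1`. -/
theorem IsAdmissibleAt.scale_le (h : IsAdmissibleAt gl gu kl ku γ) {l r : ℝ} (hl : 1 ≤ l)
    (hr : 0 < r) : γ (l * r) * (l * r) ≤ l ^ gu * (γ r * r) := by
  have hl0 : 0 < l := by linarith
  have h1 := h.mul_rpow_anti hr (le_mul_of_one_le_left hr.le hl)
  have e : ∀ t : ℝ, 0 < t → t = t ^ (1 - gu) * t ^ gu := fun t ht => by
    rw [← Real.rpow_add ht]; simp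
  calc γ (l * r) * (l * r) = γ (l * r) * (l * r) ^ (1 - gu) * (l * r) ^ gu := by
        rw [mul_assoc, ← e _ (by positivity)]
    _ ≤ γ r * r ^ (1 - gu) * (l * r) ^ gu := by gcongr
    _ = l ^ gu * (γ r * r) := by
        rw [Real.mul_rpow hl0.le hr.le]
        linear_combination (-(γ r * l ^ gu)) * e r hr

/-- `l^{g_*} γ(r) r ≤ γ(l r) l r` for `l ≥ 1`. -/
theorem IsAdmissibleAt.le_scale (h : IsAdmissibleAt gl gu kl ku γ) {l r : ℝ} (hl : 1 ≤ l)
    (hr : 0 < r) : l ^ gl * (γ r * r) ≤ γ (l * r) * (l * r) := by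
  have hl0 : 0 < l := by linarith
  have h1 := h.mul_rpow_mono hr (le_mul_of_one_le_left hr.le hl)
  have e : ∀ t : ℝ, 0 < t → t = t ^ (1 - gl) * t ^ gl := fun t ht => by
    rw [← Real.rpow_add ht]; simp
  calc l ^ gl * (γ r * r) = γ r * r ^ (1 - gl) * (l * r) ^ gl := by
        rw [Real.mul_rpow hl0.le hr.le]
        linear_combination (γ r * l ^ gl) * e r hr
    _ ≤ γ (l * r) * (l * r) ^ (1 - gl) * (l * r) ^ gl := by gcongr
    _ = γ (l * r) * (l * r) := by
        rw [mul_assoc, ← e _ (by positivity)]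

theorem IsAdmissibleAt.mul_self_mono (h : IsAdmissibleAt gl gu kl ku γ) (hgl : 0 < gl) {a b : ℝ}
    (ha : 0 < a) (hab : a ≤ b) : γ a * a ≤ γ b * b := by
  have h1 : 1 ≤ b / a := (one_le_div ha).2 hab
  have h2 := h.le_scale h1 ha
  rw [div_mul_cancel₀ _ ha.ne'] at h2
  refine le_trans ?_ h2
  exact le_mul_of_one_le_left (mul_nonneg (h.pos a ha).le ha.le) (Real.one_le_rpow h1 hgl.le)

theorem IsAdmissibleAt.le_mul_self (h : IsAdmissibleAt gl gu kl ku γ) {r : ℝ} (hr : 1 ≤ r) :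
    kl * r ^ gl ≤ γ r * r := by
  have h2 := h.le_scale hr one_pos
  simp only [mul_one] at h2
  refine le_trans ?_ h2
  rw [mul_comm]
  exact mul_le_mul_of_nonneg_left h.bound_one.1 (Real.rpow_nonneg (by linarith) _)

/-- `∫₀^r γ(ρ) ρ dρ`. -/
noncomputable def primitiveMul (γ : ℝ → ℝ) (r : ℝ) : ℝ := ∫ ρ in (0 : ℝ)..r, γ ρ * ρ

theorem IsAdmissibleAt.intervalIntegrable (h : IsAdmissibleAt gl gu kl ku γ) (hgl : 0 < gl)
    {a b : ℝ} (ha : 0 ≤ a) (hab : a ≤ b) :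
    IntervalIntegrable (fun ρ => γ ρ * ρ) volume a b := by
  -- Nothing is known about γ on ρ ≤ 0. Replacing the integrand by 0 there gives a function monotone
  -- on the whole line, hence integrable on intervals.
  have hm : Monotone (fun ρ : ℝ => if ρ ≤ 0 then 0 else γ ρ * ρ) := by
    intro x y hxy
    dsimp only
    split_ifs with h1 h2 h2
    · exact le_rfl
    · exact mul_nonneg (h.pos y (not_le.1 h2)).le (not_le.1 h2).le
    · exact absurd (hxy.trans h2) h1
    · exact h.mul_self_mono hgl (not_le.1 h1) hxy
  refine (hm.intervalIntegrable (μ := volume) (a := a) (b := b)).congr ?_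
  rw [uIoc_of_le hab]
  intro x hx
  simp [not_le.2 (ha.trans_lt hx.1)]

theorem IsAdmissibleAt.primitiveMul_sub (h : IsAdmissibleAt gl gu kl ku γ) (hgl : 0 < gl)
    {a b : ℝ} (ha : 0 ≤ a) (hab : a ≤ b) :
    primitiveMul γ b = primitiveMul γ a + ∫ ρ in a..b, γ ρ * ρ :=
  (intervalIntegral.integral_add_adjacent_intervals (h.intervalIntegrable hgl le_rfl ha)
    (h.intervalIntegrable hgl ha hab)).symm

theorem IsAdmissibleAt.integral_nonneg (h : IsAdmissibleAt gl gu kl ku γ)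
    {a b : ℝ} (ha : 0 ≤ a) (hab : a ≤ b) : 0 ≤ ∫ ρ in a..b, γ ρ * ρ := by
  rw [intervalIntegral.integral_of_le hab]
  refine setIntegral_nonneg measurableSet_Ioc fun x hx => ?_
  have : 0 < x := ha.trans_lt hx.1
  exact mul_nonneg (h.pos x this).le this.le

theorem IsAdmissibleAt.primitiveMul_nonneg (h : IsAdmissibleAt gl gu kl ku γ) {r : ℝ}
    (hr : 0 ≤ r) : 0 ≤ primitiveMul γ r := h.integral_nonneg le_rfl hr

theorem IsAdmissibleAt.primitiveMul_mono (h : IsAdmissibleAt gl gu kl ku γ) (hgl : 0 < gl)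
    {a b : ℝ} (ha : 0 ≤ a) (hab : a ≤ b) : primitiveMul γ a ≤ primitiveMul γ b := by
  rw [h.primitiveMul_sub hgl ha hab]
  linarith [h.integral_nonneg ha hab]

theorem IsAdmissibleAt.primitiveMul_le (h : IsAdmissibleAt gl gu kl ku γ) (hgl : 0 < gl)
    {r : ℝ} (hr : 0 ≤ r) : primitiveMul γ r ≤ r * (γ r * r) := by
  have h1 : primitiveMul γ r ≤ ∫ _ in (0 : ℝ)..r, γ r * r := by
    refine intervalIntegral.integral_mono_on_of_le_Ioo hr (h.intervalIntegrable hgl le_rfl hr)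
      intervalIntegrable_const fun x hx => h.mul_self_mono hgl hx.1 hx.2.le
  rwa [intervalIntegral.integral_const, sub_zero, smul_eq_mul] at h1

theorem IsAdmissibleAt.primitiveMul_mul_le (h : IsAdmissibleAt gl gu kl ku γ) (hgl : 0 < gl)
    {l r : ℝ} (hl : 1 ≤ l) (hr : 0 ≤ r) :
    primitiveMul γ (l * r) ≤ l * l ^ gu * primitiveMul γ r := by
  have hl0 : 0 < l := by linarith
  have e := intervalIntegral.mul_integral_comp_mul_left (f := fun ρ => γ ρ * ρ) l (a := 0) (b := r)
  rw [mul_zero] at e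
  rw [primitiveMul, ← e, mul_assoc]
  refine mul_le_mul_of_nonneg_left ?_ hl0.le
  rw [primitiveMul, ← intervalIntegral.integral_const_mul]
  refine intervalIntegral.integral_mono_on_of_le_Ioo hr ?_
    ((h.intervalIntegrable hgl le_rfl hr).const_mul _) fun x hx => h.scale_le hl hx.1
  have := (h.intervalIntegrable hgl le_rfl (mul_nonneg hl0.le hr)).comp_mul_left (c := l)
  simpa [hl0.ne'] using this

theorem IsAdmissibleAt.primitiveMul_mul_le_of_le_one (h : IsAdmissibleAt gl gu kl ku γ)
    (hgl : 0 < gl) {l r : ℝ} (hl0 : 0 < l) (hl : l ≤ 1) (hr : 0 ≤ r) :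
    primitiveMul γ (l * r) ≤ l * primitiveMul γ r := by
  have e := intervalIntegral.mul_integral_comp_mul_left (f := fun ρ => γ ρ * ρ) l (a := 0) (b := r)
  rw [mul_zero] at e
  rw [primitiveMul, ← e]
  refine mul_le_mul_of_nonneg_left ?_ hl0.le
  refine intervalIntegral.integral_mono_on_of_le_Ioo hr ?_
    (h.intervalIntegrable hgl le_rfl hr) fun x hx => ?_
  · have := (h.intervalIntegrable hgl le_rfl (mul_nonneg hl0.le hr)).comp_mul_left (c := l)
    simpa [hl0.ne'] using this
  · exact h.mul_self_mono hgl (mul_pos hl0 hx.1) (mul_le_of_le_one_left hx.1.le hl)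

/-- Only the part of the integral over [r, 2r] is kept, where the integrand is at least its value at
r. With doubling, this controls the energy density by the modular density. -/
theorem IsAdmissibleAt.mul_le_primitiveMul (h : IsAdmissibleAt gl gu kl ku γ) (hgl : 0 < gl)
    {r : ℝ} (hr : 0 ≤ r) : r * (γ r * r) ≤ primitiveMul γ (2 * r) := by
  rw [h.primitiveMul_sub hgl hr (by linarith)]
  have h1 : ∫ _ in r..(2 * r), γ r * r ≤ ∫ ρ in r..(2 * r), γ ρ * ρ := by
    refine intervalIntegral.integral_mono_on_of_le_Ioo (by linarith) intervalIntegrable_const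
      (h.intervalIntegrable hgl hr (by linarith)) fun x hx => ?_
    rcases hr.eq_or_lt with rfl | hr'
    · simpa using mul_nonneg (h.pos x hx.1).le hx.1.le
    · exact h.mul_self_mono hgl hr' hx.1.le
  have h2 := h.primitiveMul_nonneg hr
  rw [intervalIntegral.integral_const, smul_eq_mul] at h1
  nlinarith

theorem IsAdmissibleAt.primitiveMul_pos (h : IsAdmissibleAt gl gu kl ku γ) (hgl : 0 < gl)
    {r : ℝ} (hr : 0 < r) : 0 < primitiveMul γ r := by
  have h1 := h.mul_le_primitiveMul hgl (r := r / 2) (by linarith)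
  have h2 := h.pos (r / 2) (by linarith)
  rw [mul_div_cancel₀ _ (two_ne_zero)] at h1
  exact lt_of_lt_of_le (by positivity) h1

theorem IsAdmissibleAt.primitiveMul_add_le (h : IsAdmissibleAt gl gu kl ku γ) (hgl : 0 < gl)
    {a b : ℝ} (ha : 0 ≤ a) (hb : 0 ≤ b) :
    primitiveMul γ (a + b) ≤ 2 * 2 ^ gu * (primitiveMul γ a + primitiveMul γ b) := by
  have h1 : primitiveMul γ (a + b) ≤ primitiveMul γ (2 * max a b) :=
    h.primitiveMul_mono hgl (by positivity) (by linarith [le_max_left a b, le_max_right a b])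
  refine h1.trans ((h.primitiveMul_mul_le hgl one_le_two (le_max_of_le_left ha)).trans ?_)
  refine mul_le_mul_of_nonneg_left ?_ (by positivity)
  have := h.primitiveMul_nonneg ha
  have := h.primitiveMul_nonneg hb
  rcases max_choice a b with e | e <;> rw [e] <;> linarith

theorem IsAdmissibleAt.tendsto_primitiveMul (h : IsAdmissibleAt gl gu kl ku γ) (hgl : 0 < gl)
    {x : ℕ → ℝ} (hx : Tendsto x atTop (𝓝 0)) :
    Tendsto (fun n => primitiveMul γ |x n|) atTop (𝓝 0) := by
  have hx' : Tendsto (fun n => |x n|) atTop (𝓝 0) := by simpa using hx.abs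
  have hx'' : Tendsto (fun n => |x n| * (γ 1 * 1)) atTop (𝓝 0) := by
    simpa using hx'.mul_const (γ 1 * 1)
  refine squeeze_zero' (Eventually.of_forall fun n => h.primitiveMul_nonneg (abs_nonneg _)) ?_ hx''
  filter_upwards [hx'.eventually (gt_mem_nhds one_pos)] with n hn
  refine (h.primitiveMul_le hgl (abs_nonneg _)).trans ?_
  rcases (abs_nonneg (x n)).eq_or_lt with e | e
  · rw [← e]; simp
  · exact mul_le_mul_of_nonneg_left (h.mul_self_mono hgl e hn.le) e.le

theorem IsAdmissibleAt.tendsto_of_primitiveMul (h : IsAdmissibleAt gl gu kl ku γ) (hgl : 0 < gl)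
    {x : ℕ → ℝ} (hx : Tendsto (fun n => primitiveMul γ |x n|) atTop (𝓝 0)) :
    Tendsto x atTop (𝓝 0) := by
  rw [Metric.tendsto_atTop]
  intro ε hε
  obtain ⟨N, hN⟩ := (hx.eventually (gt_mem_nhds (h.primitiveMul_pos hgl hε))).exists_forall_of_atTop
  refine ⟨N, fun n hn => ?_⟩
  rw [Real.dist_eq, sub_zero]
  by_contra! hc
  exact absurd (hN n hn) (not_lt.2 (h.primitiveMul_mono hgl hε.le hc))

end Scalar

/-! ### Modulars over a general measure space. -/

section AbstractModular

variable {gl gu kl ku : ℝ} {X : Type*} [MeasurableSpace X] {ν : Measure X} {Γ : X → ℝ → ℝ}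

/-- The modular `∫ Φ_z(|U(z)|) dν(z)` where `Φ_z(r) = ∫₀^r Γ(z,ρ) ρ dρ`. -/
noncomputable def absModular (ν : Measure X) (Γ : X → ℝ → ℝ) (U : X → ℝ) : ℝ≥0∞ :=
  ∫⁻ z, ENNReal.ofReal (primitiveMul (Γ z) |U z|) ∂ν

/-- The primitive is a parameter integral of a jointly measurable function once the variable
endpoint is moved into an indicator. -/
theorem measurable_primitiveMul (hm : Measurable (Function.uncurry Γ)) :
    Measurable fun p : X × ℝ => primitiveMul (Γ p.1) |p.2| := by
  have e : (fun p : X × ℝ => primitiveMul (Γ p.1) |p.2|) =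
      fun p : X × ℝ => ∫ ρ, ({q : (X × ℝ) × ℝ | 0 < q.2 ∧ q.2 ≤ |q.1.2|}.indicator
        (fun q => Γ q.1.1 q.2 * q.2)) (p, ρ) := by
    ext p
    rw [primitiveMul, intervalIntegral.integral_of_le (abs_nonneg _),
      ← integral_indicator measurableSet_Ioc]
    rfl
  rw [e]
  refine (StronglyMeasurable.integral_prod_right' (Measurable.stronglyMeasurable ?_)).measurable
  refine Measurable.indicator ?_ ?_
  · exact (hm.comp (measurable_fst.fst.prodMk measurable_snd)).mul measurable_snd
  · exact (measurableSet_lt measurable_const measurable_snd).inter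
      (measurableSet_le measurable_snd (measurable_fst.snd.abs))

theorem aemeasurable_primitiveMul (hm : Measurable (Function.uncurry Γ)) {U : X → ℝ}
    (hU : AEMeasurable U ν) :
    AEMeasurable (fun z => ENNReal.ofReal (primitiveMul (Γ z) |U z|)) ν :=
  ((measurable_primitiveMul hm).comp_aemeasurable (aemeasurable_id.prodMk hU)).ennreal_ofReal

variable (ha : ∀ᵐ z ∂ν, IsAdmissibleAt gl gu kl ku (Γ z)) (hgl : 0 < gl)
include ha hgl

theorem absModular_mono {U V : X → ℝ} (h : ∀ᵐ z ∂ν, |U z| ≤ |V z|) :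
    absModular ν Γ U ≤ absModular ν Γ V := by
  refine lintegral_mono_ae ?_
  filter_upwards [ha, h] with z hz hUV
  exact ENNReal.ofReal_le_ofReal (hz.primitiveMul_mono hgl (abs_nonneg _) hUV)

theorem absModular_mul_le {U : X → ℝ} {l : ℝ} (hl : 1 ≤ l) :
    absModular ν Γ (fun z => l * U z) ≤ ENNReal.ofReal (l * l ^ gu) * absModular ν Γ U := by
  have hl0 : 0 < l := by linarith
  rw [absModular, absModular, ← lintegral_const_mul' _ _ ENNReal.ofReal_ne_top]
  refine lintegral_mono_ae ?_
  filter_upwards [ha] with z hz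
  rw [← ENNReal.ofReal_mul (by positivity), abs_mul, abs_of_pos hl0]
  exact ENNReal.ofReal_le_ofReal (hz.primitiveMul_mul_le hgl hl (abs_nonneg _))

theorem absModular_mul_le_of_le_one {U : X → ℝ} {l : ℝ} (hl0 : 0 < l) (hl : l ≤ 1) :
    absModular ν Γ (fun z => l * U z) ≤ ENNReal.ofReal l * absModular ν Γ U := by
  rw [absModular, absModular, ← lintegral_const_mul' _ _ ENNReal.ofReal_ne_top]
  refine lintegral_mono_ae ?_
  filter_upwards [ha] with z hz
  rw [← ENNReal.ofReal_mul (by positivity), abs_mul, abs_of_pos hl0]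
  exact ENNReal.ofReal_le_ofReal (hz.primitiveMul_mul_le_of_le_one hgl hl0 hl (abs_nonneg _))

theorem absModular_add_le (hm : Measurable (Function.uncurry Γ)) {U V : X → ℝ}
    (hU : AEMeasurable U ν) :
    absModular ν Γ (fun z => |U z| + |V z|) ≤
      ENNReal.ofReal (2 * 2 ^ gu) * (absModular ν Γ U + absModular ν Γ V) := by
  rw [absModular, absModular, absModular, ← lintegral_add_left' (aemeasurable_primitiveMul hm hU),
    ← lintegral_const_mul' _ _ ENNReal.ofReal_ne_top]
  refine lintegral_mono_ae ?_
  filter_upwards [ha] with z hz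
  rw [← ENNReal.ofReal_add (hz.primitiveMul_nonneg (abs_nonneg _))
    (hz.primitiveMul_nonneg (abs_nonneg _)), ← ENNReal.ofReal_mul (by positivity),
    abs_of_nonneg (by positivity : 0 ≤ |U z| + |V z|)]
  exact ENNReal.ofReal_le_ofReal (hz.primitiveMul_add_le hgl (abs_nonneg _) (abs_nonneg _))

/-- Summability makes the sum of the integrands finite almost everywhere, so they tend to 0
pointwise, and the primitive is monotone and positive off 0. No passage to a subsequence is needed.
-/
theorem ae_tendsto_of_tsum_absModular (hm : Measurable (Function.uncurry Γ)) {S : ℕ → X → ℝ}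
    (hS : ∀ n, AEMeasurable (S n) ν) (hsum : ∑' n, absModular ν Γ (S n) ≠ ⊤) :
    ∀ᵐ z ∂ν, Tendsto (fun n => S n z) atTop (𝓝 0) := by
  simp only [absModular] at hsum
  rw [← lintegral_tsum fun n => aemeasurable_primitiveMul hm (hS n)] at hsum
  filter_upwards [ha, ae_lt_top' (AEMeasurable.tsum
    fun n => aemeasurable_primitiveMul hm (hS n)) hsum] with z hz hlt
  have h1 := ENNReal.tendsto_atTop_zero_of_tsum_ne_top hlt.ne
  refine hz.tendsto_of_primitiveMul hgl ?_
  have h2 := (ENNReal.tendsto_toReal ENNReal.zero_ne_top).comp h1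
  simp only [ENNReal.toReal_zero] at h2
  exact h2.congr fun n => ENNReal.toReal_ofReal (hz.primitiveMul_nonneg (abs_nonneg _))

/-- Dominated convergence for modulars. -/
theorem tendsto_absModular (hm : Measurable (Function.uncurry Γ)) {D S : ℕ → X → ℝ} {U : X → ℝ}
    (hS : ∀ n, AEMeasurable (S n) ν) (hU : AEMeasurable U ν) (hD : ∀ n, AEMeasurable (D n) ν)
    (hsum : ∑' n, absModular ν Γ (S n) ≠ ⊤) (hUfin : absModular ν Γ U ≠ ⊤) {l : ℝ} (hl : 1 ≤ l)
    (hle : ∀ n, ∀ᵐ z ∂ν, |D n z| ≤ l * (|S n z| + |U z|))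
    (hlim : ∀ᵐ z ∂ν, Tendsto (fun n => D n z) atTop (𝓝 0)) :
    Tendsto (fun n => absModular ν Γ (D n)) atTop (𝓝 0) := by
  have hl0 : 0 < l := by linarith
  set C : ℝ := l * l ^ gu * (2 * 2 ^ gu) with hC
  have hC0 : 0 ≤ C := by positivity
  -- The sum over all n of the integrands of `S n` is an integrable majorant that serves every n at
  -- once.
  have key := tendsto_lintegral_of_dominated_convergence' (μ := ν)
    (F := fun n z => ENNReal.ofReal (primitiveMul (Γ z) |D n z|)) (f := fun _ => 0)
    (fun z => ENNReal.ofReal C * ((∑' n, ENNReal.ofReal (primitiveMul (Γ z) |S n z|)) +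
      ENNReal.ofReal (primitiveMul (Γ z) |U z|)))
    (fun n => aemeasurable_primitiveMul hm (hD n)) ?_ ?_ ?_
  · simpa [absModular] using key
  · intro n
    filter_upwards [ha, hle n] with z hz hn
    calc ENNReal.ofReal (primitiveMul (Γ z) |D n z|)
        ≤ ENNReal.ofReal (C * (primitiveMul (Γ z) |S n z| + primitiveMul (Γ z) |U z|)) := by
          refine ENNReal.ofReal_le_ofReal ?_
          refine (hz.primitiveMul_mono hgl (abs_nonneg _) hn).trans ?_
          refine (hz.primitiveMul_mul_le hgl hl (by positivity)).trans ?_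
          rw [hC, mul_assoc (l * l ^ gu)]
          exact mul_le_mul_of_nonneg_left
            (hz.primitiveMul_add_le hgl (abs_nonneg _) (abs_nonneg _)) (by positivity)
      _ ≤ _ := by
          rw [ENNReal.ofReal_mul hC0, ENNReal.ofReal_add (hz.primitiveMul_nonneg (abs_nonneg _))
            (hz.primitiveMul_nonneg (abs_nonneg _))]
          gcongr
          exact ENNReal.le_tsum n
  · rw [lintegral_const_mul' _ _ ENNReal.ofReal_ne_top,
      lintegral_add_right' _ (aemeasurable_primitiveMul hm hU),
      lintegral_tsum fun n => aemeasurable_primitiveMul hm (hS n)]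
    exact ENNReal.mul_ne_top ENNReal.ofReal_ne_top (ENNReal.add_ne_top.2 ⟨hsum, hUfin⟩)
  · filter_upwards [ha, hlim] with z hz hn
    simpa using ENNReal.tendsto_ofReal (hz.tendsto_primitiveMul hgl hn)

end AbstractModular

/-! ### Luxemburg functional versus modular: smallness and convergence. -/

section Luxemburg

variable {d : ℕ} {M : (Eucl d → ℝ) → ℝ≥0∞}

theorem le_of_luxemburg_lt
    (hM : ∀ (u : Eucl d → ℝ) (l : ℝ), 0 < l → l ≤ 1 → M (fun x => l * u x) ≤ ENNReal.ofReal l * M u)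
    {u : Eucl d → ℝ} {ε : ℝ≥0∞} (hε : ε ≤ 1) (h : luxemburg M u < ε) : M u ≤ ε := by
  obtain ⟨t, ⟨l, hl, hMl, rfl⟩, ht⟩ := sInf_lt_iff.1 h
  have hl1 : l ≤ 1 := by
    have := (ht.trans_le hε).le
    rwa [← ENNReal.ofReal_one, ENNReal.ofReal_le_ofReal_iff zero_le_one] at this
  have h1 := hM (fun x => u x / l) l hl hl1
  have e : (fun x => l * (u x / l)) = u := by
    ext x; field_simp
  rw [e] at h1
  calc M u ≤ ENNReal.ofReal l * 1 := h1.trans (by gcongr)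
    _ ≤ ε := by rw [mul_one]; exact ht.le

theorem tendsto_luxemburg
    (hM : ∀ l : ℝ, 1 ≤ l → ∃ C : ℝ≥0∞, C ≠ ⊤ ∧ ∀ u : Eucl d → ℝ, M (fun x => l * u x) ≤ C * M u)
    {u : ℕ → Eucl d → ℝ} (h : Tendsto (fun n => M (u n)) atTop (𝓝 0)) :
    Tendsto (fun n => luxemburg M (u n)) atTop (𝓝 0) := by
  rw [ENNReal.tendsto_nhds_zero]
  intro ε hε
  obtain ⟨δ, hδ0, hδ1, hδε⟩ : ∃ δ : ℝ, 0 < δ ∧ δ ≤ 1 ∧ ENNReal.ofReal δ ≤ ε := by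
    refine ⟨(min ε 1).toReal, ENNReal.toReal_pos (by simp [hε.ne']) (by simp), ?_, ?_⟩
    · exact ENNReal.toReal_le_of_le_ofReal zero_le_one (by simp)
    · rw [ENNReal.ofReal_toReal (by simp)]; exact min_le_left _ _
  obtain ⟨C, hC, hle⟩ := hM δ⁻¹ ((one_le_inv₀ hδ0).2 hδ1)
  have h2 : Tendsto (fun n => C * M (u n)) atTop (𝓝 0) := by
    simpa using ENNReal.Tendsto.const_mul h (Or.inr hC)
  filter_upwards [h2.eventually (ge_mem_nhds one_pos)] with n hn
  refine le_trans (sInf_le ⟨δ, hδ0, ?_, rfl⟩) hδε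
  have := (hle (u n)).trans hn
  simpa only [div_eq_inv_mul] using this

end Luxemburg

/-- Meant for A and B two limit functions, A' and B' the errors of their approximants, and D the
error of a composition. -/
theorem tendsto_absModular_of_approx {gl gu kl ku : ℝ} {X : Type*} [MeasurableSpace X]
    {ν : Measure X} {Γ : X → ℝ → ℝ} (ha : ∀ᵐ z ∂ν, IsAdmissibleAt gl gu kl ku (Γ z))
    (hgl : 0 < gl) (hm : Measurable (Function.uncurry Γ)) {A B : X → ℝ} {A' B' D : ℕ → X → ℝ}
    (hA : AEMeasurable A ν) (hB : AEMeasurable B ν) (hA' : ∀ n, AEMeasurable (A' n) ν)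
    (hB' : ∀ n, AEMeasurable (B' n) ν) (hD : ∀ n, AEMeasurable (D n) ν)
    (hAfin : absModular ν Γ A ≠ ⊤) (hBfin : absModular ν Γ B ≠ ⊤)
    (hAsum : ∑' n, absModular ν Γ (A' n) ≠ ⊤) (hBsum : ∑' n, absModular ν Γ (B' n) ≠ ⊤)
    {L : ℝ} (hL : 1 ≤ L)
    (hle : ∀ n z, |D n z| ≤ L * (|A' n z| + |B' n z| + (|A z| + |B z|)))
    (hlim : ∀ᵐ z ∂ν, Tendsto (fun n => D n z) atTop (𝓝 0)) :
    Tendsto (fun n => absModular ν Γ (D n)) atTop (𝓝 0) := by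
  have habs : ∀ {U : X → ℝ}, AEMeasurable U ν → AEMeasurable (fun z => |U z|) ν :=
    fun h => h.abs
  refine tendsto_absModular ha hgl hm (S := fun n z => |A' n z| + |B' n z|)
    (U := fun z => |A z| + |B z|) (fun n => (habs (hA' n)).add (habs (hB' n)))
    ((habs hA).add (habs hB)) hD ?_ ?_ hL (fun n => ae_of_all _ fun z => ?_) hlim
  · refine ne_top_of_le_ne_top ?_ (ENNReal.tsum_le_tsum fun n =>
      absModular_add_le ha hgl hm (hA' n) (V := B' n))
    rw [ENNReal.tsum_mul_left, ENNReal.tsum_add]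
    exact ENNReal.mul_ne_top ENNReal.ofReal_ne_top (ENNReal.add_ne_top.2 ⟨hAsum, hBsum⟩)
  · exact ne_top_of_le_ne_top (ENNReal.mul_ne_top ENNReal.ofReal_ne_top
      (ENNReal.add_ne_top.2 ⟨hAfin, hBfin⟩)) (absModular_add_le ha hgl hm hA)
  · rw [abs_of_nonneg (by positivity : 0 ≤ |A' n z| + |B' n z|),
      abs_of_nonneg (by positivity : 0 ≤ |A z| + |B z|)]
    exact hle n z

theorem absModular_ne_top_of_le {gl gu kl ku : ℝ} {X : Type*} [MeasurableSpace X]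
    {ν : Measure X} {Γ : X → ℝ → ℝ} (ha : ∀ᵐ z ∂ν, IsAdmissibleAt gl gu kl ku (Γ z))
    (hgl : 0 < gl) (hm : Measurable (Function.uncurry Γ)) {A B D : X → ℝ}
    (hA : AEMeasurable A ν) (hAfin : absModular ν Γ A ≠ ⊤) (hBfin : absModular ν Γ B ≠ ⊤)
    {L : ℝ} (hL : 1 ≤ L) (hle : ∀ z, |D z| ≤ L * (|A z| + |B z|)) :
    absModular ν Γ D ≠ ⊤ := by
  have h1 : absModular ν Γ D ≤ absModular ν Γ (fun z => L * (|A z| + |B z|)) :=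
    absModular_mono ha hgl (ae_of_all _ fun z => (hle z).trans (le_abs_self _))
  refine ne_top_of_le_ne_top ?_ (h1.trans (absModular_mul_le ha hgl hL))
  exact ENNReal.mul_ne_top ENNReal.ofReal_ne_top (ne_top_of_le_ne_top
    (ENNReal.mul_ne_top ENNReal.ofReal_ne_top (ENNReal.add_ne_top.2 ⟨hAfin, hBfin⟩))
    (absModular_add_le ha hgl hm hA))

/-! ### The space W_0^{s,G}: approximating sequences and composition. -/

variable {d : ℕ} {s gl gu kl ku : ℝ} {g : Eucl d → Eucl d → ℝ → ℝ} {Ω : Set (Eucl d)}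

/-- The measure `dx dy / |x - y|^d` on pairs. -/
noncomputable def pairMeasure (d : ℕ) : Measure (Eucl d × Eucl d) :=
  (volume : Measure (Eucl d × Eucl d)).withDensity
    fun z => ENNReal.ofReal (‖z.1 - z.2‖ ^ d)⁻¹

theorem modularSG_eq (s : ℝ) (g : Eucl d → Eucl d → ℝ → ℝ) (u : Eucl d → ℝ) :
    modularSG s g u = absModular (pairMeasure d) (fun z => g z.1 z.2)
      (fun z => diffQuot s u z.1 z.2) := by
  rw [absModular, pairMeasure, lintegral_withDensity_eq_lintegral_mul_non_measurable _
    (by fun_prop) (ae_of_all _ fun _ => ENNReal.ofReal_lt_top)]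
  refine lintegral_congr fun z => ?_
  simp only [Pi.mul_apply]
  rw [← ENNReal.ofReal_mul (by positivity), div_eq_inv_mul]
  rfl

theorem IsAdmissible.ae_pairMeasure (hg : IsAdmissible gl gu kl ku g) :
    ∀ᵐ z ∂pairMeasure d, IsAdmissibleAt gl gu kl ku (g z.1 z.2) :=
  (withDensity_absolutelyContinuous _ _).ae_le hg.ae

theorem IsAdmissible.measurable_diag (hg : IsAdmissible gl gu kl ku g) :
    Measurable (Function.uncurry fun x => g x x) :=
  hg.measurable.comp (measurable_fst.prodMk (measurable_fst.prodMk measurable_snd))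

theorem IsAdmissible.measurable_pair (hg : IsAdmissible gl gu kl ku g) :
    Measurable (Function.uncurry fun z : Eucl d × Eucl d => g z.1 z.2) :=
  hg.measurable.comp (measurable_fst.fst.prodMk (measurable_fst.snd.prodMk measurable_snd))

theorem ae_prod_of_ae {p : Eucl d → Prop} (h : ∀ᵐ x, p x) :
    ∀ᵐ z : Eucl d × Eucl d, p z.1 ∧ p z.2 :=
  ((Measure.quasiMeasurePreserving_fst (μ := volume) (ν := volume)).ae h).and
    ((Measure.quasiMeasurePreserving_snd (μ := volume) (ν := volume)).ae h)

theorem aemeasurable_diffQuot (s : ℝ) {u : Eucl d → ℝ} (hu : AEMeasurable u volume) :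
    AEMeasurable (fun z : Eucl d × Eucl d => diffQuot s u z.1 z.2) volume := by
  have h1 : AEMeasurable (fun z : Eucl d × Eucl d => u z.1) volume :=
    hu.comp_quasiMeasurePreserving Measure.quasiMeasurePreserving_fst
  have h2 : AEMeasurable (fun z : Eucl d × Eucl d => u z.2) volume :=
    hu.comp_quasiMeasurePreserving Measure.quasiMeasurePreserving_snd
  exact (h1.sub h2).div (by fun_prop)

theorem aemeasurable_diffQuot_pairMeasure (s : ℝ) {u : Eucl d → ℝ} (hu : AEMeasurable u volume) :
    AEMeasurable (fun z : Eucl d × Eucl d => diffQuot s u z.1 z.2) (pairMeasure d) :=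
  (aemeasurable_diffQuot s hu).mono_ac (withDensity_absolutelyContinuous _ _)

theorem diffQuot_const_mul (s l : ℝ) (u : Eucl d → ℝ) (x y : Eucl d) :
    diffQuot s (fun x => l * u x) x y = l * diffQuot s u x y := by
  simp only [diffQuot]; ring

theorem diffQuot_sub (s : ℝ) (u v : Eucl d → ℝ) (x y : Eucl d) :
    diffQuot s (u - v) x y = diffQuot s u x y - diffQuot s v x y := by
  simp only [diffQuot, Pi.sub_apply]; ring

theorem diffQuot_neg (s : ℝ) (u : Eucl d → ℝ) (x y : Eucl d) :
    diffQuot s (-u) x y = -diffQuot s u x y := by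
  simp only [diffQuot, Pi.neg_apply]; ring

theorem abs_diffQuot_le (s : ℝ) {L : ℝ} {t u v : Eucl d → ℝ} {x y : Eucl d}
    (h : |t x - t y| ≤ L * (|u x - u y| + |v x - v y|)) :
    |diffQuot s t x y| ≤ L * (|diffQuot s u x y| + |diffQuot s v x y|) := by
  have h0 : 0 ≤ ‖x - y‖ ^ s := Real.rpow_nonneg (norm_nonneg _) _
  simp only [diffQuot, abs_div, abs_of_nonneg h0]
  rw [← add_div, ← mul_div_assoc]
  exact div_le_div_of_nonneg_right h h0

theorem tendsto_normW (hg : IsAdmissible gl gu kl ku g) {u : ℕ → Eucl d → ℝ}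
    (h1 : Tendsto (fun n => modularG g (u n)) atTop (𝓝 0))
    (h2 : Tendsto (fun n => modularSG s g (u n)) atTop (𝓝 0)) :
    Tendsto (fun n => normW s g (u n)) atTop (𝓝 0) := by
  rw [← add_zero (0 : ℝ≥0∞)]
  refine (tendsto_luxemburg (fun l hl => ⟨ENNReal.ofReal (l * l ^ gu), ENNReal.ofReal_ne_top,
    fun u => ?_⟩) h1).add (tendsto_luxemburg (fun l hl => ⟨ENNReal.ofReal (l * l ^ gu),
    ENNReal.ofReal_ne_top, fun u => ?_⟩) h2)
  · exact absModular_mul_le hg.ae_diag hg.gl_pos hl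
  · simp only [modularSG_eq, diffQuot_const_mul]
    exact absModular_mul_le hg.ae_pairMeasure hg.gl_pos hl

theorem modular_le_of_normW_lt (hg : IsAdmissible gl gu kl ku g) {u : Eucl d → ℝ} {ε : ℝ≥0∞}
    (hε : ε ≤ 1) (h : normW s g u < ε) : modularG g u ≤ ε ∧ modularSG s g u ≤ ε := by
  constructor
  · exact le_of_luxemburg_lt (fun u l hl0 hl =>
      absModular_mul_le_of_le_one hg.ae_diag hg.gl_pos hl0 hl) hε (le_self_add.trans_lt h)
  · refine le_of_luxemburg_lt (fun u l hl0 hl => ?_) hε (le_add_self.trans_lt h)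
    simp only [modularSG_eq, diffQuot_const_mul]
    exact absModular_mul_le_of_le_one hg.ae_pairMeasure hg.gl_pos hl0 hl

/-- Approximants with error below 2^{-n} in norm have summable modulars, since below 1 the modular
is bounded by the norm; almost everywhere convergence follows. -/
theorem MemW0.exists_seq (hg : IsAdmissible gl gu kl ku g) {u : Eucl d → ℝ}
    (hu : MemW0 s g Ω u) : ∃ w : ℕ → Eucl d → ℝ,
      (∀ n, ContDiff ℝ ∞ (w n) ∧ HasCompactSupport (w n) ∧ tsupport (w n) ⊆ Ω) ∧
      ∑' n, modularG g (u - w n) ≠ ⊤ ∧ ∑' n, modularSG s g (u - w n) ≠ ⊤ ∧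
      ∀ᵐ x, Tendsto (fun n => (u - w n) x) atTop (𝓝 0) := by
  choose w h1 h2 h3 h4 using fun n : ℕ => hu.2 ((2⁻¹ : ℝ≥0∞) ^ n) (ENNReal.pow_pos (by simp) n)
  have hle : ∀ n : ℕ, (2⁻¹ : ℝ≥0∞) ^ n ≤ 1 := fun n => pow_le_one₀ zero_le (by simp)
  have hs : ∑' n : ℕ, (2⁻¹ : ℝ≥0∞) ^ n ≠ ⊤ := by
    rw [ENNReal.tsum_geometric]; simp
  have hG : ∑' n, modularG g (u - w n) ≠ ⊤ := ne_top_of_le_ne_top hs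
    (ENNReal.tsum_le_tsum fun n => (modular_le_of_normW_lt hg (hle n) (h4 n)).1)
  refine ⟨w, fun n => ⟨h1 n, h2 n, h3 n⟩, hG, ne_top_of_le_ne_top hs
    (ENNReal.tsum_le_tsum fun n => (modular_le_of_normW_lt hg (hle n) (h4 n)).2), ?_⟩
  exact ae_tendsto_of_tsum_absModular hg.ae_diag hg.gl_pos hg.measurable_diag
    (fun n => (hu.1.1.sub (h1 n).continuous.aestronglyMeasurable).aemeasurable) hG

theorem MemW0.ae_eq_zero (hg : IsAdmissible gl gu kl ku g) {u : Eucl d → ℝ}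
    (hu : MemW0 s g Ω u) : ∀ᵐ x, x ∉ Ω → u x = 0 := by
  obtain ⟨w, hw, -, -, hlim⟩ := hu.exists_seq hg
  filter_upwards [hlim] with x hx hxΩ
  refine tendsto_nhds_unique (tendsto_const_nhds (x := u x)) (hx.congr fun n => ?_)
  rw [Pi.sub_apply, image_eq_zero_of_notMem_tsupport fun h => hxΩ ((hw n).2.2 h), sub_zero]

theorem MemW0.mono {Ω' : Set (Eucl d)} (h : Ω ⊆ Ω') {u : Eucl d → ℝ} (hu : MemW0 s g Ω u) :
    MemW0 s g Ω' u := by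
  refine ⟨hu.1, fun ε hε => ?_⟩
  obtain ⟨w, h1, h2, h3, h4⟩ := hu.2 ε hε
  exact ⟨w, h1, h2, h3.trans h, h4⟩

/-- Smooth Lipschitz functions `F` with `F(·,0) = 0` operate on `W_0^{s,G}`. -/
theorem MemW0.comp (hg : IsAdmissible gl gu kl ku g) {F : ℝ → ℝ → ℝ}
    (hF : ContDiff ℝ ∞ (Function.uncurry F)) {L : ℝ} (hL1 : 1 ≤ L)
    (hL : ∀ a b a' b', |F a b - F a' b'| ≤ L * (|a - a'| + |b - b'|)) (hF0 : ∀ a, F a 0 = 0)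
    {ψ u : Eucl d → ℝ} (hψ : MemW0 s g univ ψ) (hu : MemW0 s g Ω u) :
    MemW0 s g Ω fun x => F (ψ x) (u x) := by
  have hmeas : ∀ {a b : Eucl d → ℝ}, AEMeasurable a volume → AEMeasurable b volume →
      AEMeasurable (fun x => F (a x) (b x)) volume := fun ha hb =>
    hF.continuous.measurable.comp_aemeasurable (ha.prodMk hb)
  have hpt : ∀ a b, |F a b| ≤ L * (|a| + |b|) := fun a b => by
    simpa [hF0] using hL a b 0 0
  have hψm := hψ.1.1.aemeasurable
  have hum := hu.1.1.aemeasurable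
  have hψ2 := hψ.1.2.2.ne
  have hu2 := hu.1.2.2.ne
  rw [modularSG_eq] at hψ2 hu2
  refine ⟨⟨(hmeas hψm hum).aestronglyMeasurable, lt_top_iff_ne_top.2 ?_,
    lt_top_iff_ne_top.2 ?_⟩, ?_⟩
  · exact absModular_ne_top_of_le hg.ae_diag hg.gl_pos hg.measurable_diag hψm hψ.1.2.1.ne
      hu.1.2.1.ne hL1 fun x => hpt _ _
  · rw [modularSG_eq]
    exact absModular_ne_top_of_le hg.ae_pairMeasure hg.gl_pos hg.measurable_pair
      (aemeasurable_diffQuot_pairMeasure s hψm) hψ2 hu2 hL1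
      fun z => abs_diffQuot_le s (hL _ _ _ _)
  intro ε hε
  obtain ⟨p, hp, hpG, hpS, hplim⟩ := hψ.exists_seq hg
  obtain ⟨w, hw, hwG, hwS, hwlim⟩ := hu.exists_seq hg
  have hpm : ∀ n, AEMeasurable (p n) volume := fun n => (hp n).1.continuous.aemeasurable
  have hwm : ∀ n, AEMeasurable (w n) volume := fun n => (hw n).1.continuous.aemeasurable
  set T : Eucl d → ℝ := fun x => F (ψ x) (u x) with hT
  -- Since F(·,0) = 0, the support lies in that of `w n`, hence compactly in Ω, although `p n` need
  -- not vanish outside Ω.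
  set T' : ℕ → Eucl d → ℝ := fun n x => F (p n x) (w n x) with hT'
  have hDm : ∀ n, AEMeasurable (T - T' n) volume := fun n =>
    (hmeas hψm hum).sub (hmeas (hpm n) (hwm n))
  have hlim : ∀ᵐ x, Tendsto (fun n => (T - T' n) x) atTop (𝓝 0) := by
    filter_upwards [hplim, hwlim] with x h1 h2
    refine squeeze_zero_norm (fun n => hL _ _ _ _) ?_
    simpa using (h1.abs.add h2.abs).const_mul L
  have hL2 : 1 ≤ 2 * L := by linarith
  -- Lipschitz continuity of F alone does not bound the quotient of T - T' by those of the errors.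
  -- The bound therefore keeps the limits |a| + |b|, and smallness comes from pointwise convergence.
  have hbd : ∀ {a b a' b' t t' : ℝ}, |t| ≤ L * (|a| + |b|) → |t'| ≤ L * (|a'| + |b'|) →
      |t - t'| ≤ 2 * L * (|a - a'| + |b - b'| + (|a| + |b|)) := by
    intro a b a' b' t t' h1 h2
    have h3 : |a'| ≤ |a - a'| + |a| := by
      have := abs_sub_abs_le_abs_sub a' a
      rw [abs_sub_comm] at this; linarith
    have h4 : |b'| ≤ |b - b'| + |b| := by
      have := abs_sub_abs_le_abs_sub b' b
      rw [abs_sub_comm] at this; linarith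
    calc |t - t'| ≤ |t| + |t'| := abs_sub _ _
      _ ≤ L * (|a| + |b| + (|a'| + |b'|)) := by linarith
      _ ≤ L * (2 * (|a - a'| + |b - b'| + (|a| + |b|))) := by
          refine mul_le_mul_of_nonneg_left ?_ (by linarith)
          linarith [abs_nonneg (a - a'), abs_nonneg (b - b')]
      _ = _ := by ring
  have hG : Tendsto (fun n => modularG g (T - T' n)) atTop (𝓝 0) := by
    refine tendsto_absModular_of_approx hg.ae_diag hg.gl_pos hg.measurable_diag hψm hum
      (fun n => hψm.sub (hpm n)) (fun n => hum.sub (hwm n)) hDm hψ.1.2.1.ne hu.1.2.1.ne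
      hpG hwG hL2 (fun n x => hbd (hpt _ _) (hpt _ _)) hlim
  have hS : Tendsto (fun n => modularSG s g (T - T' n)) atTop (𝓝 0) := by
    simp only [modularSG_eq] at hpS hwS ⊢
    refine tendsto_absModular_of_approx hg.ae_pairMeasure hg.gl_pos hg.measurable_pair
      (aemeasurable_diffQuot_pairMeasure s hψm) (aemeasurable_diffQuot_pairMeasure s hum)
      (fun n => aemeasurable_diffQuot_pairMeasure s (hψm.sub (hpm n)))
      (fun n => aemeasurable_diffQuot_pairMeasure s (hum.sub (hwm n)))
      (fun n => aemeasurable_diffQuot_pairMeasure s (hDm n)) hψ2 hu2 hpS hwS hL2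
      (fun n z => ?_) ?_
    · simp only [diffQuot_sub]
      exact hbd (abs_diffQuot_le s (hL _ _ _ _)) (abs_diffQuot_le s (hL _ _ _ _))
    · refine (withDensity_absolutelyContinuous _ _).ae_le ?_
      filter_upwards [ae_prod_of_ae hlim] with z hz
      simpa [diffQuot] using (hz.1.sub hz.2).div_const (‖z.1 - z.2‖ ^ s)
  obtain ⟨n, hn⟩ := ((tendsto_normW hg hG hS).eventually (gt_mem_nhds hε)).exists
  have hsupp : Function.support (T' n) ⊆ Function.support (w n) := by
    intro x hx h0
    exact hx (by simp only [hT', h0, hF0])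
  exact ⟨T' n, hF.comp ((hp n).1.prodMk (hw n).1), (hw n).2.1.mono hsupp,
    (closure_mono hsupp).trans (hw n).2.2, hn⟩

/-! ### The iteration lemma. -/

/-- A De Giorgi–Stampacchia iteration lemma. -/
theorem exists_eq_zero_of_decay {a : ℝ → ℝ} {k₀ K C e ε σ : ℝ} (ha0 : ∀ k, 0 ≤ a k)
    (ha : AntitoneOn a (Ici k₀)) (hK : 0 ≤ K) (hC : 0 ≤ C) (he : 0 < e) (hε : 0 < ε) (hσ : 0 < σ)
    (H : ∀ k, k₀ ≤ k → ∀ τ, 0 < τ → C * a k ^ σ ≤ τ → a (k + τ) * τ ^ e ≤ K * a k ^ (1 + ε)) :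
    ∃ M, k₀ ≤ M ∧ a M = 0 := by
  set A := a k₀ with hA
  have hA0 : 0 ≤ A := ha0 _
  -- With q = 2^{-κ}, this is what gives q^ε ≤ 2^{-e} and q^σ ≤ 1/2: the decay of a then keeps pace
  -- with the halving of τ both in the recursion and in its side condition.
  set κ : ℝ := max (e / ε) (1 / σ) with hκ
  have hκ1 : e ≤ κ * ε := (div_le_iff₀ hε).1 (le_max_left _ _)
  have hκ2 : 1 ≤ κ * σ := (div_le_iff₀ hσ).1 (le_max_right _ _)
  have hκ0 : 0 < κ := lt_of_lt_of_le (by positivity) (le_max_left _ _)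
  set q : ℝ := (1 / 2 : ℝ) ^ κ with hq
  have hq0 : 0 < q := by positivity
  have hq1 : q < 1 := Real.rpow_lt_one (by norm_num) (by norm_num) hκ0
  have hqε : q ^ ε ≤ (1 / 2 : ℝ) ^ e := by
    rw [hq, ← Real.rpow_mul (by norm_num)]
    exact Real.rpow_le_rpow_of_exponent_ge (by norm_num) (by norm_num) hκ1
  have hqσ : q ^ σ ≤ 1 / 2 := by
    rw [hq, ← Real.rpow_mul (by norm_num)]
    exact (Real.rpow_le_rpow_of_exponent_ge (by norm_num) (by norm_num) hκ2).trans_eq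
      (Real.rpow_one _)
  set B : ℝ := K * A ^ ε * 2 ^ e / q with hB
  have hB0 : 0 ≤ B := by positivity
  -- D is the total height climbed. The second entry secures the side condition on τ at every step,
  -- the third the gain of a factor q.
  set D : ℝ := max 1 (max (2 * C * A ^ σ) (B ^ (1 / e))) with hD
  have hD1 : 1 ≤ D := le_max_left _ _
  have hD0 : 0 < D := by linarith
  have hDσ : 2 * C * A ^ σ ≤ D := (le_max_left _ _).trans (le_max_right _ _)
  have hDe : K * A ^ ε * 2 ^ e ≤ q * D ^ e := by
    have h1 : B ^ (1 / e) ≤ D := (le_max_right _ _).trans (le_max_right _ _)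
    have h2 := Real.rpow_le_rpow (by positivity) h1 he.le
    rw [← Real.rpow_mul hB0, one_div_mul_cancel he.ne', Real.rpow_one, hB, div_le_iff₀ hq0] at h2
    linarith
  set κs : ℕ → ℝ := fun j => k₀ + D * (1 - (1 / 2) ^ j) with hks
  have hpow1 : ∀ j : ℕ, (1 / 2 : ℝ) ^ j ≤ 1 := fun j => pow_le_one₀ (by norm_num) (by norm_num)
  have hks0 : ∀ j, k₀ ≤ κs j := fun j => by
    have := mul_nonneg hD0.le (sub_nonneg.2 (hpow1 j))
    simp only [hks]; linarith
  have hks1 : ∀ j, κs j ≤ k₀ + D := fun j => by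
    have : 0 < D * (1 / 2 : ℝ) ^ j := by positivity
    simp only [hks]; nlinarith
  have claim : ∀ j, a (κs j) ≤ A * q ^ j := by
    intro j
    induction j with
    | zero => simp [hks, hA]
    | succ j ih =>
      set x := q ^ j with hx
      have hx0 : 0 < x := by positivity
      set τ : ℝ := D * (1 / 2) ^ (j + 1) with hτ
      have hτ0 : 0 < τ := by positivity
      have hstep : κs (j + 1) = κs j + τ := by
        simp only [hks, hτ, pow_succ]; ring
      have hxσ : x ^ σ ≤ (1 / 2) ^ j := by
        rw [hx, ← Real.rpow_pow_comm hq0.le]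
        exact pow_le_pow_left₀ (by positivity) hqσ j
      have hxε : x ^ ε ≤ ((1 / 2 : ℝ) ^ j) ^ e := by
        rw [hx, ← Real.rpow_pow_comm hq0.le, ← Real.rpow_pow_comm (by norm_num)]
        exact pow_le_pow_left₀ (by positivity) hqε j
      have h1 : C * a (κs j) ^ σ ≤ τ := by
        calc C * a (κs j) ^ σ ≤ C * (A * x) ^ σ := by
              gcongr
              exact ha0 _
          _ = C * A ^ σ * x ^ σ := by rw [Real.mul_rpow hA0 hx0.le]; ring
          _ ≤ (D / 2) * (1 / 2) ^ j := by
              refine mul_le_mul (by linarith) hxσ (by positivity) (by positivity)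
          _ = τ := by simp only [hτ, pow_succ]; ring
      have h2 := H (κs j) (hks0 j) τ hτ0 h1
      rw [← hstep] at h2
      have hτe : (0 : ℝ) < τ ^ e := by positivity
      have hτe' : τ ^ e * 2 ^ e = D ^ e * ((1 / 2 : ℝ) ^ j) ^ e := by
        rw [← Real.mul_rpow hτ0.le (by norm_num), ← Real.mul_rpow hD0.le (by positivity)]
        congr 1
        simp only [hτ, pow_succ]; ring
      have h3 : K * A ^ ε * x ^ ε ≤ q * τ ^ e := by
        have h4 : (K * A ^ ε * x ^ ε) * 2 ^ e ≤ (q * τ ^ e) * 2 ^ e := by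
          calc (K * A ^ ε * x ^ ε) * 2 ^ e = (K * A ^ ε * 2 ^ e) * x ^ ε := by ring
            _ ≤ (q * D ^ e) * ((1 / 2 : ℝ) ^ j) ^ e := by gcongr
            _ = (q * τ ^ e) * 2 ^ e := by rw [mul_assoc q, ← hτe']; ring
        exact le_of_mul_le_mul_right h4 (by positivity)
      refine le_of_mul_le_mul_right ?_ hτe
      calc a (κs (j + 1)) * τ ^ e ≤ K * a (κs j) ^ (1 + ε) := h2
        _ ≤ K * (A * x) ^ (1 + ε) := by
            gcongr
            exact ha0 _
        _ = A * x * (K * A ^ ε * x ^ ε) := by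
            rw [Real.rpow_add_of_nonneg (by positivity) zero_le_one hε.le, Real.rpow_one,
              Real.mul_rpow hA0 hx0.le]
            ring
        _ ≤ A * x * (q * τ ^ e) := by gcongr
        _ = A * q ^ (j + 1) * τ ^ e := by rw [pow_succ]; ring
  refine ⟨k₀ + D, by linarith, le_antisymm ?_ (ha0 _)⟩
  have hlim : Tendsto (fun j : ℕ => A * q ^ j) atTop (𝓝 0) := by
    simpa using (tendsto_pow_atTop_nhds_zero_of_lt_one hq0.le hq1).const_mul A
  refine ge_of_tendsto' hlim fun j => (ha (hks0 j) ?_ (hks1 j)).trans (claim j)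
  exact mem_Ici.2 (by linarith)

/-! ### Smooth truncations. -/

theorem exists_lipschitz_smoothTransition : ∃ C : ℝ, 1 ≤ C ∧ ∀ x y,
    |Real.smoothTransition x - Real.smoothTransition y| ≤ C * |x - y| := by
  have h1 : LocallyLipschitzOn (Icc (0 : ℝ) 1) Real.smoothTransition :=
    ((Real.smoothTransition.contDiff (n := 1)).locallyLipschitz).locallyLipschitzOn
  obtain ⟨K, hK⟩ := h1.exists_lipschitzOnWith_of_compact isCompact_Icc
  refine ⟨max 1 K, le_max_left _ _, fun x y => ?_⟩
  rw [← Real.smoothTransition.projIcc (x := x), ← Real.smoothTransition.projIcc (x := y)]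
  have h2 := hK.dist_le_mul _ (projIcc (0 : ℝ) 1 zero_le_one x).2 _
    (projIcc (0 : ℝ) 1 zero_le_one y).2
  rw [Real.dist_eq, Real.dist_eq] at h2
  have h3 := abs_projIcc_sub_projIcc (a := (0 : ℝ)) (b := 1) (c := x) (d := y) zero_le_one
  exact h2.trans (mul_le_mul (le_max_right _ _) h3 (abs_nonneg _) (by positivity))

/-- A smooth nondecreasing function that vanishes on `(-∞,k]` and equals `τ / C` on
`[k + τ, ∞)`. -/
noncomputable def smoothTrunc (C k τ r : ℝ) : ℝ := τ / C * Real.smoothTransition ((r - k) / τ)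

section SmoothTrunc

variable {C k τ : ℝ}

theorem contDiff_smoothTrunc : ContDiff ℝ ∞ (smoothTrunc C k τ) :=
  contDiff_const.mul (Real.smoothTransition.contDiff.comp
    ((contDiff_id.sub contDiff_const).div_const _))

theorem smoothTrunc_mono (hC : 1 ≤ C) (hτ : 0 < τ) : Monotone (smoothTrunc C k τ) := by
  intro x y hxy
  unfold smoothTrunc
  have : 0 < C := by linarith
  gcongr
  exact Real.smoothTransition.monotone (by gcongr)

theorem smoothTrunc_nonneg (hC : 1 ≤ C) (hτ : 0 < τ) (r : ℝ) : 0 ≤ smoothTrunc C k τ r := by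
  have : 0 < C := by linarith
  exact mul_nonneg (by positivity) (Real.smoothTransition.nonneg _)

theorem smoothTrunc_le (hC : 1 ≤ C) (hτ : 0 < τ) (r : ℝ) : smoothTrunc C k τ r ≤ τ / C := by
  have : 0 < C := by linarith
  exact mul_le_of_le_one_right (by positivity) (Real.smoothTransition.le_one _)

theorem smoothTrunc_of_le (hτ : 0 < τ) {r : ℝ} (hr : r ≤ k) : smoothTrunc C k τ r = 0 := by
  rw [smoothTrunc, Real.smoothTransition.zero_of_nonpos, mul_zero]
  exact div_nonpos_of_nonpos_of_nonneg (by linarith) hτ.le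

theorem smoothTrunc_of_ge (hτ : 0 < τ) {r : ℝ} (hr : k + τ ≤ r) :
    smoothTrunc C k τ r = τ / C := by
  rw [smoothTrunc, Real.smoothTransition.one_of_one_le, mul_one]
  rw [one_le_div hτ]; linarith

/-- This is the purpose of the height τ/C: the Lipschitz constant C/τ of the rescaled transition is
cancelled exactly. -/
theorem abs_smoothTrunc_sub_le (hC : 1 ≤ C) (hτ : 0 < τ)
    (hS : ∀ x y, |Real.smoothTransition x - Real.smoothTransition y| ≤ C * |x - y|) (x y : ℝ) :
    |smoothTrunc C k τ x - smoothTrunc C k τ y| ≤ |x - y| := by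
  have hC0 : 0 < C := by linarith
  rw [smoothTrunc, smoothTrunc, ← mul_sub, abs_mul, abs_of_pos (by positivity)]
  calc τ / C * |Real.smoothTransition ((x - k) / τ) - Real.smoothTransition ((y - k) / τ)|
      ≤ τ / C * (C * |(x - k) / τ - (y - k) / τ|) := by gcongr; exact hS _ _
    _ = |x - y| := by
        rw [← sub_div, abs_div, abs_of_pos hτ, sub_sub_sub_cancel_right]
        field_simp

/-- `T(r) ≤ (r - k)⁺` for the truncation `T`. -/
theorem smoothTrunc_le_sub (hC : 1 ≤ C) (hτ : 0 < τ)
    (hS : ∀ x y, |Real.smoothTransition x - Real.smoothTransition y| ≤ C * |x - y|) {r : ℝ}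
    (hr : k ≤ r) : smoothTrunc C k τ r ≤ r - k := by
  have h1 := abs_smoothTrunc_sub_le hC hτ hS (k := k) r k
  rw [smoothTrunc_of_le hτ le_rfl, sub_zero, abs_of_nonneg (sub_nonneg.2 hr)] at h1
  exact (le_abs_self _).trans h1

end SmoothTrunc

/-! ### The energy form and its bounds on truncations. -/

theorem opL_congr {u u' v v' : Eucl d → ℝ} (hu : u =ᵐ[volume] u') (hv : v =ᵐ[volume] v') :
    opL s g u v = opL s g u' v' := by
  refine integral_congr_ae ?_
  filter_upwards [ae_prod_of_ae hu, ae_prod_of_ae hv] with z h1 h2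
  simp only [diffQuot, h1.1, h1.2, h2.1, h2.2]

theorem opL_neg_left (u v : Eucl d → ℝ) : opL s g (-u) v = -opL s g u v := by
  rw [opL, opL, ← integral_neg]
  refine integral_congr_ae (ae_of_all _ fun z => ?_)
  simp only [diffQuot_neg, abs_neg]
  ring

theorem opL_neg_right (u v : Eucl d → ℝ) : opL s g u (-v) = -opL s g u v := by
  rw [opL, opL, ← integral_neg]
  refine integral_congr_ae (ae_of_all _ fun z => ?_)
  simp only [diffQuot_neg]
  ring

theorem pairing_neg_right (f v : Eucl d → ℝ) : pairing Ω f (-v) = -pairing Ω f v := by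
  rw [pairing, pairing, ← integral_neg]
  simp

theorem pairing_neg_left (f v : Eucl d → ℝ) : pairing Ω (-f) v = -pairing Ω f v := by
  rw [pairing, pairing, ← integral_neg]
  simp

theorem modularSG_congr {u u' : Eucl d → ℝ} (hu : u =ᵐ[volume] u') :
    modularSG s g u = modularSG s g u' := by
  refine lintegral_congr_ae ?_
  filter_upwards [ae_prod_of_ae hu] with z h1
  simp only [diffQuot, h1.1, h1.2]

/-- The integrand is at most g(r) r², with r = |δ^s u|, and this is at most G(2r) ≤ 2·2^{g^*} G(r),
which is integrable against |x-y|^{-d}. -/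
theorem integrable_opL (hg : IsAdmissible gl gu kl ku g) {u v : Eucl d → ℝ}
    (hu : AEMeasurable u volume) (hv : AEMeasurable v volume) (hfin : modularSG s g u ≠ ⊤)
    (hle : ∀ x y, |v x - v y| ≤ |u x - u y|) :
    Integrable (fun z : Eucl d × Eucl d => g z.1 z.2 |diffQuot s u z.1 z.2| *
      diffQuot s u z.1 z.2 * diffQuot s v z.1 z.2 / ‖z.1 - z.2‖ ^ d) volume := by
  have hum := aemeasurable_diffQuot s hu
  have hvm := aemeasurable_diffQuot s hv
  have hden : Measurable fun z : Eucl d × Eucl d => ‖z.1 - z.2‖ ^ d := by fun_prop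
  have hΦm : AEMeasurable (fun z : Eucl d × Eucl d =>
      bigG g z.1 z.2 |diffQuot s u z.1 z.2| / ‖z.1 - z.2‖ ^ d) volume :=
    ((measurable_primitiveMul hg.measurable_pair).comp_aemeasurable
      (aemeasurable_id.prodMk hum)).div hden.aemeasurable
  have hΦ : Integrable (fun z : Eucl d × Eucl d =>
      bigG g z.1 z.2 |diffQuot s u z.1 z.2| / ‖z.1 - z.2‖ ^ d) volume := by
    refine ⟨hΦm.aestronglyMeasurable, ?_⟩
    rw [hasFiniteIntegral_iff_ofReal]
    · exact lt_top_iff_ne_top.2 hfin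
    · filter_upwards [hg.ae] with z hz
      exact div_nonneg (hz.primitiveMul_nonneg (abs_nonneg _)) (by positivity)
  refine (hΦ.const_mul (2 * 2 ^ gu)).mono' ?_ ?_
  · have hgm : AEMeasurable (fun z : Eucl d × Eucl d =>
        g z.1 z.2 |diffQuot s u z.1 z.2|) volume :=
      hg.measurable_pair.comp_aemeasurable (aemeasurable_id.prodMk hum.abs)
    exact (((hgm.mul hum).mul hvm).div hden.aemeasurable).aestronglyMeasurable
  · filter_upwards [hg.ae] with z hz
    have hvu : |diffQuot s v z.1 z.2| ≤ |diffQuot s u z.1 z.2| := by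
      have := abs_diffQuot_le s (t := v) (u := u) (v := 0) (L := 1) (x := z.1) (y := z.2)
        (by simpa using hle z.1 z.2)
      simpa [diffQuot] using this
    rw [norm_div, norm_pow, norm_norm, ← mul_div_assoc]
    refine div_le_div_of_nonneg_right ?_ (by positivity)
    set r := |diffQuot s u z.1 z.2| with hr
    have hr0 : 0 ≤ r := abs_nonneg _
    have h1 := (hz.mul_le_primitiveMul hg.gl_pos hr0).trans
      (hz.primitiveMul_mul_le hg.gl_pos one_le_two hr0)
    rw [norm_mul, norm_mul, Real.norm_eq_abs, Real.norm_eq_abs, Real.norm_eq_abs, ← hr]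
    rcases hr0.eq_or_lt with h0 | h0
    · rw [← h0, mul_zero, zero_mul]
      exact mul_nonneg (by positivity) (hz.primitiveMul_nonneg le_rfl)
    · have hp := hz.pos r h0
      rw [abs_of_pos hp]
      calc g z.1 z.2 r * r * |diffQuot s v z.1 z.2| ≤ g z.1 z.2 r * r * r := by gcongr
        _ = r * (g z.1 z.2 r * r) := by ring
        _ ≤ _ := h1

/-- For each x with w(x) > l, removing {w > k} from a ball of twice its measure leaves at least that
measure; integrate over x. -/
theorem mul_volume_le_volume_pairs {w : Eucl d → ℝ} (hw : Measurable w) (k l : ℝ) {ρ : ℝ}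
    (hball : ∀ x : Eucl d, volume (Metric.ball x ρ) = 2 * volume {x | k < w x})
    (hfin : volume {x | k < w x} ≠ ⊤) :
    volume {x | l < w x} * volume {x | k < w x} ≤
      volume {z : Eucl d × Eucl d | l < w z.1 ∧ w z.2 ≤ k ∧ ‖z.1 - z.2‖ < ρ} := by
  have hS : MeasurableSet {z : Eucl d × Eucl d | l < w z.1 ∧ w z.2 ≤ k ∧ ‖z.1 - z.2‖ < ρ} := by
    refine (measurableSet_lt measurable_const (hw.comp measurable_fst)).inter
      ((measurableSet_le (hw.comp measurable_snd) measurable_const).inter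
      (measurableSet_lt (measurable_fst.sub measurable_snd).norm measurable_const))
  rw [Measure.volume_eq_prod, Measure.prod_apply hS, mul_comm,
    ← setLIntegral_const {x | l < w x}]
  refine (setLIntegral_mono' (measurableSet_lt measurable_const hw) fun x hx => ?_).trans
    (setLIntegral_le_lintegral _ _)
  have h1 : Metric.ball x ρ \ {x | k < w x} ⊆
      Prod.mk x ⁻¹' {z : Eucl d × Eucl d | l < w z.1 ∧ w z.2 ≤ k ∧ ‖z.1 - z.2‖ < ρ} := by
    rintro y ⟨hy, hyk⟩
    refine ⟨hx, not_lt.1 hyk, ?_⟩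
    rwa [Metric.mem_ball, dist_comm, dist_eq_norm] at hy
  refine le_trans ?_ (measure_mono h1)
  refine le_trans ?_ le_measure_sdiff
  rw [hball, two_mul, ENNReal.add_sub_cancel_right hfin]

/-- Lower bound of the energy of a truncation in terms of the measure of pairs of points
that lie on different sides of it. -/
theorem mul_volume_pairs_le_opL (hg : IsAdmissible gl gu kl ku g) (hs : 0 < s) {w : Eucl d → ℝ}
    (hw : Measurable w) (hfin : modularSG s g w ≠ ⊤) {C k τ ρ : ℝ} (hC : 1 ≤ C) (hτ : 0 < τ)
    (hS : ∀ x y, |Real.smoothTransition x - Real.smoothTransition y| ≤ C * |x - y|)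
    (hρ : 0 < ρ) (hτρ : ρ ^ s ≤ τ / C) :
    ENNReal.ofReal (kl * (τ / C / ρ ^ s) ^ (gl + 1) / ρ ^ d) *
      volume {z : Eucl d × Eucl d | k + τ < w z.1 ∧ w z.2 ≤ k ∧ ‖z.1 - z.2‖ < ρ} ≤
      ENNReal.ofReal (opL s g w fun x => smoothTrunc C k τ (w x)) := by
  have hC0 : 0 < C := by linarith
  set T : Eucl d → ℝ := fun x => smoothTrunc C k τ (w x) with hT
  have hTm : Measurable T := contDiff_smoothTrunc.continuous.measurable.comp hw
  have hint := integrable_opL (s := s) (v := T) hg hw.aemeasurable hTm.aemeasurable hfin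
    fun x y => abs_smoothTrunc_sub_le hC hτ hS _ _
  have hnn : ∀ᵐ z : Eucl d × Eucl d, 0 ≤ g z.1 z.2 |diffQuot s w z.1 z.2| *
      diffQuot s w z.1 z.2 * diffQuot s T z.1 z.2 / ‖z.1 - z.2‖ ^ d := by
    filter_upwards [hg.ae] with z hz
    refine div_nonneg ?_ (by positivity)
    rcases eq_or_ne (diffQuot s w z.1 z.2) 0 with h0 | h0
    · rw [h0]; simp
    rw [mul_assoc]
    refine mul_nonneg (hz.pos _ (abs_pos.2 h0)).le ?_
    have h2 : 0 ≤ (w z.1 - w z.2) * (T z.1 - T z.2) := by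
      rcases le_total (w z.1) (w z.2) with h | h
      · exact mul_nonneg_of_nonpos_of_nonpos (sub_nonpos.2 h)
          (sub_nonpos.2 (smoothTrunc_mono hC hτ h))
      · exact mul_nonneg (sub_nonneg.2 h) (sub_nonneg.2 (smoothTrunc_mono hC hτ h))
    simp only [diffQuot, div_mul_div_comm]
    have := Real.rpow_nonneg (norm_nonneg (z.1 - z.2)) s
    positivity
  rw [opL, ofReal_integral_eq_lintegral_ofReal hint hnn]
  -- Markov's inequality: the integrand is nonnegative because T is monotone in w, so it remains to
  -- bound it below on the pairs counted.
  refine le_trans (mul_le_mul_right (measure_mono_ae ?_) _)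
    (mul_meas_ge_le_lintegral₀ hint.aemeasurable.ennreal_ofReal _)
  filter_upwards [hg.ae] with z hz hmem
  obtain ⟨h1, h2, h3⟩ := hmem
  refine ENNReal.ofReal_le_ofReal ?_
  have hδ : 0 < ‖z.1 - z.2‖ := by
    rw [norm_pos_iff, sub_ne_zero]
    intro h
    rw [h] at h1; linarith
  set D := ‖z.1 - z.2‖ with hD
  have hDs : 0 < D ^ s := Real.rpow_pos_of_pos hδ _
  have hρs : 0 < ρ ^ s := Real.rpow_pos_of_pos hρ _
  have hDρ : D ^ s ≤ ρ ^ s := Real.rpow_le_rpow hδ.le h3.le hs.le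
  have ht0 : 0 < τ / C := by positivity
  have e1 : diffQuot s T z.1 z.2 = τ / C / D ^ s := by
    simp only [diffQuot, hT]
    rw [smoothTrunc_of_ge hτ h1.le, smoothTrunc_of_le hτ h2, sub_zero]
  have e2 : τ / C / D ^ s ≤ diffQuot s w z.1 z.2 := by
    simp only [diffQuot]
    refine div_le_div_of_nonneg_right ?_ hDs.le
    have : τ / C ≤ τ := div_le_self hτ.le hC
    linarith
  have e3 : 1 ≤ τ / C / ρ ^ s := (one_le_div hρs).2 hτρ
  have e4 : τ / C / ρ ^ s ≤ τ / C / D ^ s := by gcongr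
  set r := τ / C / ρ ^ s with hr
  set r' := τ / C / D ^ s with hr'
  have hr0 : 0 < r := by linarith
  rw [e1, abs_of_pos (by linarith)]
  have hkl := hg.kl_pos
  refine div_le_div₀ ?_ ?_ (by positivity) (by gcongr)
  · have := hz.pos (diffQuot s w z.1 z.2) (by linarith)
    exact mul_nonneg (mul_nonneg this.le (by linarith)) (by linarith)
  · calc kl * r ^ (gl + 1) = kl * r ^ gl * r := by
          rw [Real.rpow_add hr0, Real.rpow_one, mul_assoc]
      _ ≤ g z.1 z.2 (diffQuot s w z.1 z.2) * diffQuot s w z.1 z.2 * r' := by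
          refine mul_le_mul ?_ e4 hr0.le ?_
          · exact (hz.le_mul_self e3).trans (hz.mul_self_mono hg.gl_pos hr0 (e4.trans e2))
          · exact mul_nonneg (hz.pos _ (by linarith)).le (by linarith)

/-- Hölder's inequality on {w > k}, outside which the truncation vanishes. -/
theorem pairing_smoothTrunc_le {m : ℝ≥0∞} (hm : 1 ≤ m) {h w : Eucl d → ℝ}
    (hh : MemLp h m (volume.restrict Ω)) (hw : Measurable w) {C k τ : ℝ} (hC : 1 ≤ C)
    (hτ : 0 < τ) :
    ENNReal.ofReal (pairing Ω h fun x => smoothTrunc C k τ (w x)) ≤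
      ENNReal.ofReal (τ / C) * (eLpNorm h m (volume.restrict Ω) *
        volume {x | k < w x} ^ (1 - 1 / m.toReal)) := by
  set A := {x | k < w x} with hA
  have hAm : MeasurableSet A := measurableSet_lt measurable_const hw
  have hC0 : 0 < C := by linarith
  have e1 : 0 ≤ 1 - 1 / m.toReal := by
    rcases eq_or_ne m ⊤ with rfl | htop
    · simp
    · have : 1 ≤ m.toReal := by simpa using ENNReal.toReal_mono htop hm
      rw [sub_nonneg, div_le_one (by linarith)]
      exact this
  calc ENNReal.ofReal (pairing Ω h fun x => smoothTrunc C k τ (w x))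
      ≤ ‖pairing Ω h fun x => smoothTrunc C k τ (w x)‖ₑ := Real.ofReal_le_enorm _
    _ ≤ ∫⁻ x in Ω, ‖h x * smoothTrunc C k τ (w x)‖ₑ := enorm_integral_le_lintegral_enorm _
    _ ≤ ∫⁻ x in Ω, A.indicator (fun x => ENNReal.ofReal (τ / C) * ‖h x‖ₑ) x := by
        refine lintegral_mono fun x => ?_
        by_cases hx : x ∈ A
        · rw [indicator_of_mem hx, enorm_mul, mul_comm]
          gcongr
          rw [Real.enorm_of_nonneg (smoothTrunc_nonneg hC hτ _)]
          exact ENNReal.ofReal_le_ofReal (smoothTrunc_le hC hτ _)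
        · rw [smoothTrunc_of_le hτ (not_lt.1 hx)]
          simp
    _ = ENNReal.ofReal (τ / C) * eLpNorm h 1 ((volume.restrict Ω).restrict A) := by
        rw [lintegral_indicator hAm, lintegral_const_mul' _ _ ENNReal.ofReal_ne_top,
          eLpNorm_one_eq_lintegral_enorm]
    _ ≤ _ := by
        gcongr
        refine (eLpNorm_le_eLpNorm_mul_rpow_measure_univ hm
          hh.aestronglyMeasurable.restrict).trans ?_
        rw [ENNReal.toReal_one, div_one]
        refine mul_le_mul' (eLpNorm_mono_measure h Measure.restrict_le_self)
          (ENNReal.rpow_le_rpow ?_ e1)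
        rw [Measure.restrict_apply_univ]
        exact Measure.restrict_apply_le _ _

/-- Functions whose truncations satisfy the energy inequality are bounded above. -/
theorem exists_le_of_energy_le_of_measurable (hs : 0 < s) (hsd : s * (gl + 1) < d)
    (hg : IsAdmissible gl gu kl ku g)
    (hΩb : Bornology.IsBounded Ω) {m : ℝ≥0∞} (hm : ENNReal.ofReal ((d : ℝ) / (s * (gl + 1))) < m)
    {h w : Eucl d → ℝ} (hh : MemLp h m (volume.restrict Ω)) (hw : Measurable w)
    (hfin : modularSG s g w ≠ ⊤) (hout : ∀ᵐ x, x ∉ Ω → w x ≤ 0) {C k₀ : ℝ} (hC : 1 ≤ C)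
    (hS : ∀ x y, |Real.smoothTransition x - Real.smoothTransition y| ≤ C * |x - y|)
    (hk₀ : 0 ≤ k₀)
    (H : ∀ k, k₀ ≤ k → ∀ τ, 0 < τ → opL s g w (fun x => smoothTrunc C k τ (w x)) ≤
      pairing Ω h fun x => smoothTrunc C k τ (w x)) :
    ∃ M, k₀ ≤ M ∧ ∀ᵐ x, w x ≤ M := by
  have hC0 : 0 < C := by linarith
  have hgl := hg.gl_pos
  have hkl := hg.kl_pos
  have hp : 0 < gl + 1 := by linarith
  have hsp : 0 < s * (gl + 1) := by positivity
  have hd : (0 : ℝ) < d := hsp.trans hsd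
  have hd' : d ≠ 0 := by
    rintro rfl
    simp at hd
  have : Nonempty (Fin d) := ⟨⟨0, Nat.pos_of_ne_zero hd'⟩⟩
  have hm1 : 1 ≤ m := by
    refine le_trans ?_ hm.le
    rw [ENNReal.one_le_ofReal, one_le_div hsp]
    exact hsd.le
  -- For m = ∞ the conventions `⊤.toReal = 0` and `1 / 0 = 0` give the correct value θ = 0.
  set θ : ℝ := 1 / m.toReal with hθ
  have hθlt : θ < s * (gl + 1) / d := by
    rcases eq_or_ne m ⊤ with rfl | htop
    · simp only [hθ, ENNReal.toReal_top, div_zero]; positivity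
    · have h1 : (d : ℝ) / (s * (gl + 1)) < m.toReal :=
        (ENNReal.ofReal_lt_iff_lt_toReal (by positivity) htop).1 hm
      rw [hθ, ← one_div_div (d : ℝ)]
      exact one_div_lt_one_div_of_lt (by positivity) h1
  set ε : ℝ := s * (gl + 1) / d - θ with hε
  have hε0 : 0 < ε := sub_pos.2 hθlt
  set V : ℝ≥0∞ := volume (Metric.ball (0 : Eucl d) 1) with hV
  have hVtop : V ≠ ⊤ := measure_ball_lt_top.ne
  have hV0 : V ≠ 0 := (Metric.measure_ball_pos _ _ one_pos).ne'
  set c : ℝ := V.toReal with hc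
  have hc0 : 0 < c := ENNReal.toReal_pos hV0 hVtop
  set N : ℝ := (eLpNorm h m (volume.restrict Ω)).toReal with hN
  have hN0 : 0 ≤ N := ENNReal.toReal_nonneg
  have hμ : ∀ k, k₀ ≤ k → volume {x | k < w x} ≠ ⊤ := by
    intro k hk
    refine ne_top_of_le_ne_top hΩb.measure_lt_top.ne (measure_mono_ae ?_)
    filter_upwards [hout] with x hx hkx
    by_contra hxΩ
    have h1 := hx hxΩ
    have h2 : k < w x := hkx
    linarith
  set a : ℝ → ℝ := fun k => (volume {x | k < w x}).toReal with ha
  have ha0 : ∀ k, 0 ≤ a k := fun k => ENNReal.toReal_nonneg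
  have hanti : AntitoneOn a (Ici k₀) := fun k hk l _ hkl =>
    ENNReal.toReal_mono (hμ k hk) (measure_mono fun x hx => lt_of_le_of_lt hkl hx)
  have key : ∀ k, k₀ ≤ k → ∀ τ, 0 < τ → C * (2 / c) ^ (s / d) * a k ^ (s / d) ≤ τ →
      a (k + τ) * τ ^ gl ≤
        N / kl * C ^ gl * (2 / c) ^ (1 + s * (gl + 1) / d) * a k ^ (1 + ε) := by
    intro k hk τ hτ hcond
    -- If a(k) = 0, the radius below would be 0; then a(k+τ) = 0 by monotonicity.
    rcases (ha0 k).eq_or_lt with hak | hak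
    · have h1 : a (k + τ) ≤ a k := hanti hk (hk.trans (by linarith) : k₀ ≤ k + τ) (by linarith)
      have h2 : a (k + τ) = 0 := le_antisymm (h1.trans hak.symm.le) (ha0 _)
      rw [h2, zero_mul]
      exact mul_nonneg (by positivity) (Real.rpow_nonneg (ha0 k) _)
    set ρ : ℝ := (2 * a k / c) ^ (1 / (d : ℝ)) with hρ
    have hb0 : 0 < 2 * a k / c := by positivity
    have hρ0 : 0 < ρ := by positivity
    have hρd : ρ ^ d = 2 * a k / c := by
      rw [hρ, ← Real.rpow_natCast, ← Real.rpow_mul hb0.le, one_div_mul_cancel hd.ne', Real.rpow_one]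
    have hρs : ρ ^ s = (2 * a k / c) ^ (s / d) := by
      rw [hρ, ← Real.rpow_mul hb0.le]; congr 1; ring
    have hball : ∀ x : Eucl d, volume (Metric.ball x ρ) = 2 * volume {x | k < w x} := by
      intro x
      rw [Measure.addHaar_ball volume x hρ0.le, finrank_euclideanSpace_fin, hρd, ← hV,
        ← ENNReal.ofReal_toReal hVtop, ← hc, ← ENNReal.ofReal_mul hb0.le, div_mul_cancel₀ _ hc0.ne',
        ENNReal.ofReal_mul zero_le_two, ENNReal.ofReal_toReal (hμ k hk)]
      simp
    have hτρ : ρ ^ s ≤ τ / C := by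
      -- The side condition on τ in the iteration is precisely ρ^s ≤ τ/C.
      rw [hρs, le_div_iff₀ hC0, show 2 * a k / c = 2 / c * a k by ring,
        Real.mul_rpow (by positivity) hak.le]
      linarith
    have h1 := (mul_le_mul_right (mul_volume_le_volume_pairs hw k (k + τ) hball (hμ k hk))
      (ENNReal.ofReal (kl * (τ / C / ρ ^ s) ^ (gl + 1) / ρ ^ d))).trans
      ((mul_volume_pairs_le_opL hg hs hw hfin hC hτ hS hρ0 hτρ).trans
      ((ENNReal.ofReal_le_ofReal (H k hk τ hτ)).trans (pairing_smoothTrunc_le hm1 hh hw hC hτ)))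
    have hθ1 : 0 ≤ 1 - θ := by
      have : s * (gl + 1) / d ≤ 1 := (div_le_one hd).2 hsd.le
      linarith
    have h2 := ENNReal.toReal_mono (ENNReal.mul_ne_top ENNReal.ofReal_ne_top
      (ENNReal.mul_ne_top hh.eLpNorm_ne_top (ENNReal.rpow_ne_top_of_nonneg hθ1 (hμ k hk)))) h1
    have ht0 : 0 < τ / C := by positivity
    have hρs0 : 0 < ρ ^ s := by positivity
    rw [ENNReal.toReal_mul, ENNReal.toReal_mul, ENNReal.toReal_mul, ENNReal.toReal_mul,
      ← ENNReal.toReal_rpow, ENNReal.toReal_ofReal (by positivity),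
      ENNReal.toReal_ofReal ht0.le] at h2
    change kl * (τ / C / ρ ^ s) ^ (gl + 1) / ρ ^ d * (a (k + τ) * a k) ≤
      τ / C * (N * a k ^ (1 - θ)) at h2
    have hsplit : (τ / C / ρ ^ s) ^ (gl + 1) =
        τ ^ gl / C ^ gl * (τ / C) / (2 * a k / c) ^ (s * (gl + 1) / d) := by
      rw [Real.div_rpow ht0.le hρs0.le, Real.rpow_add ht0, Real.rpow_one, Real.div_rpow hτ.le hC0.le,
        hρs, ← Real.rpow_mul hb0.le]
      congr 2; ring
    set Q : ℝ := (2 * a k / c) ^ (s * (gl + 1) / d) with hQ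
    have hQ0 : 0 < Q := by positivity
    have hCgl : 0 < C ^ gl := by positivity
    have hτgl : 0 < τ ^ gl := by positivity
    rw [hsplit, hρd] at h2
    have h3 : a (k + τ) * τ ^ gl ≤
        N / kl * C ^ gl * ((2 * a k / c) * Q) * (a k ^ (1 - θ) / a k) := by
      have e : kl * (τ ^ gl / C ^ gl * (τ / C) / Q) / (2 * a k / c) * (a (k + τ) * a k) =
          (a (k + τ) * τ ^ gl) * (kl * (τ / C) * a k / (C ^ gl * Q * (2 * a k / c))) := by
        field_simp
      have e' : τ / C * (N * a k ^ (1 - θ)) =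
          (N / kl * C ^ gl * ((2 * a k / c) * Q) * (a k ^ (1 - θ) / a k)) *
            (kl * (τ / C) * a k / (C ^ gl * Q * (2 * a k / c))) := by
        field_simp
      rw [e, e'] at h2
      exact le_of_mul_le_mul_right h2 (by positivity)
    refine h3.trans_eq ?_
    have e1 : (2 * a k / c) * Q = (2 / c) ^ (1 + s * (gl + 1) / d) *
        a k ^ (1 + s * (gl + 1) / d) := by
      rw [← Real.mul_rpow (by positivity) hak.le, Real.rpow_add (by positivity), Real.rpow_one, hQ,
        show 2 * a k / c = 2 / c * a k by ring]
    have e2 : a k ^ (1 - θ) / a k = a k ^ (-θ) := by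
      rw [Real.rpow_sub hak, Real.rpow_one, Real.rpow_neg hak.le]
      field_simp
    have e3 : a k ^ (1 + s * (gl + 1) / d) * a k ^ (-θ) = a k ^ (1 + ε) := by
      rw [← Real.rpow_add hak]; congr 1; rw [hε]; ring
    rw [e1, e2, ← e3]
    ring
  obtain ⟨M, hM, hM0⟩ := exists_eq_zero_of_decay (a := a) (k₀ := k₀)
    (K := N / kl * C ^ gl * (2 / c) ^ (1 + s * (gl + 1) / d)) (C := C * (2 / c) ^ (s / d))
    (e := gl) (ε := ε) (σ := s / d) ha0 hanti (by positivity) (by positivity) hgl hε0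
    (by positivity) key
  refine ⟨M, hM, ?_⟩
  have h1 : volume {x | M < w x} = 0 := by
    rcases (ENNReal.toReal_eq_zero_iff _).1 hM0 with h | h
    · exact h
    · exact absurd h (hμ M hM)
  rw [ae_iff]
  simpa only [not_le] using h1

theorem exists_le_of_energy_le (hs : 0 < s) (hsd : s * (gl + 1) < d)
    (hg : IsAdmissible gl gu kl ku g)
    (hΩb : Bornology.IsBounded Ω) {m : ℝ≥0∞} (hm : ENNReal.ofReal ((d : ℝ) / (s * (gl + 1))) < m)
    {h w : Eucl d → ℝ} (hh : MemLp h m (volume.restrict Ω)) (hw : MemW s g w)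
    (hout : ∀ᵐ x, x ∉ Ω → w x ≤ 0) {C k₀ : ℝ} (hC : 1 ≤ C)
    (hS : ∀ x y, |Real.smoothTransition x - Real.smoothTransition y| ≤ C * |x - y|)
    (hk₀ : 0 ≤ k₀)
    (H : ∀ k, k₀ ≤ k → ∀ τ, 0 < τ → opL s g w (fun x => smoothTrunc C k τ (w x)) ≤
      pairing Ω h fun x => smoothTrunc C k τ (w x)) :
    ∃ M, k₀ ≤ M ∧ ∀ᵐ x, w x ≤ M := by
  obtain ⟨w', hw', hae⟩ := hw.1.aemeasurable
  have hfin := hw.2.2.ne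
  rw [modularSG_congr hae] at hfin
  obtain ⟨M, hM, hle⟩ := exists_le_of_energy_le_of_measurable hs hsd hg hΩb hm hh hw' hfin
    (by filter_upwards [hae, hout] with x h1 h2; rwa [← h1]) hC hS hk₀ fun k hk τ hτ => by
      have hT : (fun x => smoothTrunc C k τ (w x)) =ᵐ[volume] fun x => smoothTrunc C k τ (w' x) :=
        hae.mono fun x hx => by simp only [hx]
      rw [← opL_congr hae hT]
      refine (H k hk τ hτ).trans_eq (integral_congr_ae ?_)
      filter_upwards [ae_restrict_of_ae hT] with x hx
      rw [hx]
  exact ⟨M, hM, by filter_upwards [hae, hle] with x h1 h2; rwa [h1]⟩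

/-! ### Admissible test functions. -/

theorem MemW0.comp_single (hg : IsAdmissible gl gu kl ku g) {F : ℝ → ℝ} (hF : ContDiff ℝ ∞ F)
    {L : ℝ} (hL1 : 1 ≤ L) (hL : ∀ a b, |F a - F b| ≤ L * |a - b|) (hF0 : F 0 = 0)
    {u : Eucl d → ℝ} (hu : MemW0 s g Ω u) : MemW0 s g Ω fun x => F (u x) :=
  MemW0.comp hg (F := fun _ b => F b) (hF.comp contDiff_snd) hL1
    (fun a b a' b' => (hL b b').trans
      (mul_le_mul_of_nonneg_left (le_add_of_nonneg_left (abs_nonneg _)) (by linarith)))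
    (fun _ => hF0) (hu.mono (subset_univ Ω)) hu

theorem MemW0.neg (hg : IsAdmissible gl gu kl ku g) {u : Eucl d → ℝ} (hu : MemW0 s g Ω u) :
    MemW0 s g Ω (-u) :=
  hu.comp_single hg (F := fun b => -b) contDiff_neg le_rfl
    (fun a b => by rw [one_mul, neg_sub_neg, abs_sub_comm]) neg_zero

theorem MemW0.sub_smoothTrunc (hg : IsAdmissible gl gu kl ku g) {u : Eucl d → ℝ}
    (hu : MemW0 s g Ω u) {C k τ : ℝ} (hC : 1 ≤ C) (hτ : 0 < τ) (hk : 0 ≤ k)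
    (hS : ∀ x y, |Real.smoothTransition x - Real.smoothTransition y| ≤ C * |x - y|) :
    MemW0 s g Ω fun x => u x - smoothTrunc C k τ (u x) := by
  refine hu.comp_single hg (F := fun b => b - smoothTrunc C k τ b)
    (contDiff_id.sub contDiff_smoothTrunc) one_le_two (fun a b => ?_) ?_
  · rw [sub_sub_sub_comm]
    refine (abs_sub _ _).trans ?_
    linarith [abs_smoothTrunc_sub_le (k := k) hC hτ hS a b]
  · simp [smoothTrunc_of_le hτ hk]

/-- Truncations of a function that is dominated by an element of `W_0^{s,G}(Ω)` belong to
`W_0^{s,G}(Ω)`, up to a null set. -/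
theorem MemW0.exists_smoothTrunc (hg : IsAdmissible gl gu kl ku g) {ψ u : Eucl d → ℝ}
    (hψ : MemW0 s g univ ψ) (hψΩ : ∀ᵐ x, x ∉ Ω → ψ x ≤ 0) (hu : MemW0 s g Ω u)
    (hψu : ∀ᵐ x, x ∈ Ω → ψ x ≤ u x) {C k τ : ℝ} (hC : 1 ≤ C) (hτ : 0 < τ) (hk : 1 ≤ k)
    (hS : ∀ x y, |Real.smoothTransition x - Real.smoothTransition y| ≤ C * |x - y|) :
    ∃ v, MemW0 s g Ω v ∧ (∀ x, 0 ≤ v x) ∧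
      v =ᵐ[volume] fun x => smoothTrunc C k τ (ψ x) := by
  have hC0 : 0 < C := by linarith
  -- The factor in u brings the product into W_0^{s,G}(Ω). It changes nothing almost everywhere:
  -- where ψ > k ≥ 1 the point lies in Ω and u ≥ ψ > 1, so the factor is 1.
  refine ⟨fun x => smoothTrunc C k τ (ψ x) * Real.smoothTransition (u x), ?_, fun x =>
    mul_nonneg (smoothTrunc_nonneg hC hτ _) (Real.smoothTransition.nonneg _), ?_⟩
  · refine MemW0.comp hg (F := fun a b => smoothTrunc C k τ a * Real.smoothTransition b)
      ((contDiff_smoothTrunc.comp contDiff_fst).mul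
        (Real.smoothTransition.contDiff.comp contDiff_snd)) (L := 1 + τ) (by linarith)
      (fun a b a' b' => ?_) (fun a => by simp) hψ hu
    have e : smoothTrunc C k τ a * Real.smoothTransition b -
        smoothTrunc C k τ a' * Real.smoothTransition b' =
        (smoothTrunc C k τ a - smoothTrunc C k τ a') * Real.smoothTransition b +
        smoothTrunc C k τ a' * (Real.smoothTransition b - Real.smoothTransition b') := by ring
    have h1 : |(smoothTrunc C k τ a - smoothTrunc C k τ a') * Real.smoothTransition b| ≤
        |a - a'| := by
      rw [abs_mul, abs_of_nonneg (Real.smoothTransition.nonneg b)]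
      exact (mul_le_of_le_one_right (abs_nonneg _) (Real.smoothTransition.le_one b)).trans
        (abs_smoothTrunc_sub_le hC hτ hS a a')
    have h2 : |smoothTrunc C k τ a' * (Real.smoothTransition b - Real.smoothTransition b')| ≤
        τ * |b - b'| := by
      rw [abs_mul, abs_of_nonneg (smoothTrunc_nonneg hC hτ a')]
      calc smoothTrunc C k τ a' * |Real.smoothTransition b - Real.smoothTransition b'|
          ≤ τ / C * (C * |b - b'|) := mul_le_mul (smoothTrunc_le hC hτ _) (hS b b')
            (abs_nonneg _) (by positivity)
        _ = τ * |b - b'| := by field_simp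
    rw [e]
    refine (abs_add_le _ _).trans ((add_le_add h1 h2).trans ?_)
    have := mul_nonneg hτ.le (abs_nonneg (a - a'))
    linarith [abs_nonneg (b - b')]
  · filter_upwards [hψΩ, hψu] with x h1 h2
    rcases le_or_gt (ψ x) k with h | h
    · rw [smoothTrunc_of_le hτ h, zero_mul]
    · have hxΩ : x ∈ Ω := by
        by_contra hx
        linarith [h1 hx]
      rw [Real.smoothTransition.one_of_one_le (by linarith [h2 hxΩ]), mul_one]

/-! ### Bounds for obstacles and for solutions. -/

/-- A lower obstacle that is a subsolution with right-hand side in `L^m` is bounded above. -/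
theorem exists_le_of_subsolution (hs : 0 < s) (hsd : s * (gl + 1) < d)
    (hg : IsAdmissible gl gu kl ku g)
    (hΩb : Bornology.IsBounded Ω) {m : ℝ≥0∞} (hm : ENNReal.ofReal ((d : ℝ) / (s * (gl + 1))) < m)
    {h ψ u : Eucl d → ℝ} (hh : MemLp h m (volume.restrict Ω)) (hψ : MemW0 s g univ ψ)
    (hψΩ : ∀ᵐ x, x ∉ Ω → ψ x ≤ 0) (hu : MemW0 s g Ω u) (hψu : ∀ᵐ x, x ∈ Ω → ψ x ≤ u x)
    (hsub : DualLE s g Ω (opL s g ψ) (pairing Ω h)) : ∃ M, 1 ≤ M ∧ ∀ᵐ x, ψ x ≤ M := by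
  obtain ⟨C, hC, hS⟩ := exists_lipschitz_smoothTransition
  refine exists_le_of_energy_le hs hsd hg hΩb hm hh hψ.1 hψΩ hC hS zero_le_one
    fun k hk τ hτ => ?_
  obtain ⟨v, hv, hv0, hvae⟩ := hψ.exists_smoothTrunc hg hψΩ hu hψu hC hτ hk hS
  rw [← opL_congr (EventuallyEq.refl _ ψ) hvae]
  refine (hsub v hv (ae_of_all _ hv0)).trans_eq (integral_congr_ae ?_)
  filter_upwards [ae_restrict_of_ae hvae] with x hx
  rw [hx]

/-- Solutions of obstacle problems are bounded if high truncations preserve the constraint. -/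
theorem memLp_top_of_isObstacleSolution (hs : 0 < s) (hsd : s * (gl + 1) < d)
    (hg : IsAdmissible gl gu kl ku g)
    (hΩb : Bornology.IsBounded Ω) {m : ℝ≥0∞} (hm : ENNReal.ofReal ((d : ℝ) / (s * (gl + 1))) < m)
    {f u : Eucl d → ℝ} (hf : MemLp f m (volume.restrict Ω)) {K : Set (Eucl d → ℝ)}
    (hu : IsObstacleSolution s g (pairing Ω f) K u) (huW : MemW0 s g Ω u) {k₀ : ℝ} (hk₀ : 0 ≤ k₀)
    (hup : ∀ v, MemW0 s g Ω v → (∀ x, v x ≤ u x) → (∀ x, min (u x) k₀ ≤ v x) → v ∈ K)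
    (hlow : ∀ v, MemW0 s g Ω v → (∀ x, u x ≤ v x) → (∀ x, v x ≤ max (u x) (-k₀)) → v ∈ K) :
    MemLp u ⊤ (volume.restrict Ω) := by
  obtain ⟨C, hC, hS⟩ := exists_lipschitz_smoothTransition
  have hle : ∀ {k τ : ℝ}, k₀ ≤ k → 0 < τ → ∀ r, min r k₀ ≤ r - smoothTrunc C k τ r := by
    intro k τ hk hτ r
    rcases le_total r k with h | h
    · rw [smoothTrunc_of_le hτ h, sub_zero]
      exact min_le_left _ _
    · exact (min_le_right _ _).trans (by linarith [smoothTrunc_le_sub hC hτ hS h])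
  have hout := huW.ae_eq_zero hg
  obtain ⟨M₁, -, h1⟩ := exists_le_of_energy_le hs hsd hg hΩb hm hf huW.1
    (hout.mono fun x hx h => (hx h).le) hC hS hk₀ fun k hk τ hτ => by
      -- The competitor u - T(u) makes v - u = -T(u), so the variational inequality is the required
      -- energy inequality.
      have hvK := hup _ (huW.sub_smoothTrunc hg hC hτ (hk₀.trans hk) hS)
        (fun x => sub_le_self _ (smoothTrunc_nonneg hC hτ _)) fun x => hle hk hτ _
      have h2 := hu.2 _ hvK
      have e : (fun x => u x - smoothTrunc C k τ (u x)) - u =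
          -fun x => smoothTrunc C k τ (u x) := by
        ext x; simp
      rw [e, opL_neg_right, pairing_neg_right] at h2
      linarith
  have hnW := huW.neg hg
  obtain ⟨M₂, -, h2⟩ := exists_le_of_energy_le (h := -f) (w := -u) hs hsd hg hΩb hm hf.neg hnW.1
    (hout.mono fun x hx h => by simp [hx h]) hC hS hk₀ fun k hk τ hτ => by
      -- The competitor is u + T(-u), written as the negative of the truncated -u.
      have hvK := hlow _ ((hnW.sub_smoothTrunc hg hC hτ (hk₀.trans hk) hS).neg hg)
        (fun x => by
          have := smoothTrunc_nonneg (k := k) hC hτ ((-u) x)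
          simp only [Pi.neg_apply] at this ⊢
          linarith) fun x => by
          have := hle hk hτ ((-u) x)
          have e : min (-u x) k₀ = -max (u x) (-k₀) := by rw [← min_neg_neg, neg_neg]
          simp only [Pi.neg_apply, e] at this ⊢
          linarith
      have h2 := hu.2 _ hvK
      have e : (-fun x => (-u) x - smoothTrunc C k τ ((-u) x)) - u =
          fun x => smoothTrunc C k τ ((-u) x) := by
        ext x; simp
      rw [e] at h2
      rw [opL_neg_left, pairing_neg_left]
      linarith
  refine memLp_top_of_bound huW.1.1.restrict (max M₁ M₂) (ae_restrict_of_ae ?_)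
  filter_upwards [h1, h2] with x hx1 hx2
  rw [Real.norm_eq_abs, abs_le']
  exact ⟨hx1.trans (le_max_left _ _), hx2.trans (le_max_right _ _)⟩

end FracObstacle

theorem mainTheorem7 (d : ℕ) (s gl gu kl ku : ℝ) (hs₀ : 0 < s) (hs₁ : s < 1)
    (hsd : s * (gl + 1) < d)
    (g : FracObstacle.Eucl d → FracObstacle.Eucl d → ℝ → ℝ)
    (hg : FracObstacle.IsAdmissible gl gu kl ku g)
    (Ω : Set (FracObstacle.Eucl d)) (hΩ : IsOpen Ω) (hΩb : Bornology.IsBounded Ω)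
    (m : ℝ≥0∞) (hm : ENNReal.ofReal ((d : ℝ) / (s * (gl + 1))) < m)
    (f ψ : FracObstacle.Eucl d → ℝ)
    (hf : MemLp f m (volume.restrict Ω))
    (hψ : FracObstacle.MemW0 s g Set.univ ψ) (hψΩ : ∀ᵐ x, x ∉ Ω → ψ x ≤ 0)
    (hfψ : FracObstacle.SupMemLp s g Ω m f ψ) :
    (∀ u, FracObstacle.IsObstacleSolution s g (FracObstacle.pairing Ω f)
        (FracObstacle.obstacleSet₁ s g Ω ψ) u → MemLp u ⊤ (volume.restrict Ω)) ∧
    (∀ φ : FracObstacle.Eucl d → ℝ,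
      FracObstacle.MemW0 s g Set.univ φ → (∀ᵐ x, x ∉ Ω → 0 ≤ φ x) →
      FracObstacle.InfMemLp s g Ω m f φ →
      ∀ u, FracObstacle.IsObstacleSolution s g (FracObstacle.pairing Ω f)
        (FracObstacle.obstacleSet₂ s g Ω ψ φ) u → MemLp u ⊤ (volume.restrict Ω)) := by
  obtain ⟨h, hh, hsup⟩ := hfψ
  constructor
  · intro u hu
    obtain ⟨huW, hψu⟩ := hu.1
    obtain ⟨M, hM1, hM⟩ := FracObstacle.exists_le_of_subsolution hs₀ hsd hg hΩb hm hh hψ hψΩ huW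
      ((ae_restrict_iff' hΩ.measurableSet).1 hψu) hsup.right_le
    refine FracObstacle.memLp_top_of_isObstacleSolution hs₀ hsd hg hΩb hm hf hu huW
      (zero_le_one.trans hM1) (fun v hv _ h2 => ⟨hv, ?_⟩) (fun v hv h1 _ => ⟨hv, ?_⟩)
    · filter_upwards [hψu, ae_restrict_of_ae hM] with x hx1 hx2
      exact (le_min hx1 hx2).trans (h2 x)
    · filter_upwards [hψu] with x hx
      exact hx.trans (h1 x)
  · rintro φ hφ hφΩ ⟨h', hh', hinf⟩ u hu
    obtain ⟨huW, hψu⟩ := hu.1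
    have hψφ := (ae_restrict_iff' hΩ.measurableSet).1 hψu
    obtain ⟨M, hM1, hM⟩ := FracObstacle.exists_le_of_subsolution hs₀ hsd hg hΩb hm hh hψ hψΩ huW
      (hψφ.mono fun x hx hxΩ => (hx hxΩ).1) hsup.right_le
    -- As ℒ is odd, -φ is a subsolution with right-hand side -(f ∧ ℒφ) lying below -u in Ω, so φ ≥
    -- -M'.
    obtain ⟨M', -, hM'⟩ := FracObstacle.exists_le_of_subsolution (h := -h') (ψ := -φ) (u := -u)
      hs₀ hsd hg hΩb hm hh'.neg (hφ.neg hg)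
      (hφΩ.mono fun x hx hxΩ => neg_nonpos.2 (hx hxΩ)) (huW.neg hg)
      (hψφ.mono fun x hx hxΩ => neg_le_neg (hx hxΩ).2) fun v hv hv0 => by
        rw [FracObstacle.opL_neg_left, FracObstacle.pairing_neg_left]
        exact neg_le_neg (hinf.le_right v hv hv0)
    refine FracObstacle.memLp_top_of_isObstacleSolution hs₀ hsd hg hΩb hm hf hu huW
      (k₀ := max M M') (le_max_of_le_left (zero_le_one.trans hM1))
      (fun v hv h1 h2 => ⟨hv, ?_⟩) (fun v hv h1 h2 => ⟨hv, ?_⟩)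
    · filter_upwards [hψu, ae_restrict_of_ae hM] with x hx1 hx2
      exact ⟨(le_min hx1.1 (hx2.trans (le_max_left _ _))).trans (h2 x), (h1 x).trans hx1.2⟩
    · filter_upwards [hψu, ae_restrict_of_ae hM'] with x hx1 hx2
      refine ⟨hx1.1.trans (h1 x), (h2 x).trans (max_le hx1.2 ?_)⟩
      exact neg_le.1 (hx2.trans (le_max_right _ _))
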